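/- **Setting.** Let $\lambda$ be the security parameter and let $C_T>0$ be a real constant. All other parameters are functions of $\lambda$, and $\log$ is to base $2$. Let $q$ be a prime, let $\ell,n,m,w\ge 1$ be polynomially bounded integers with $w=n\lceil\log q\rceil$, and let $B_L,B_V$ be positive integers such that, with $B_P=\frac{q}{2C_T\sqrt{mn\log q}}$, 1. $n\ge c\,\ell\log q$ for all large $\lambda$, for some constant $c>1$, and $m=\Omega(n\log q)$; 2. $2\sqrt n\le B_L<B_V<B_P$; 3. $B_P/B_V$ and $B_V/B_L$ are super-polynomial in $\lambda$. For $x\in\mathbb Z_q$ let $|x|$ be the absolute value of its representative in $(-q/2,q/2]$. Let $D_{\mathbb Z_q,B}$ be the truncated discrete Gaussian on $\mathbb Z_q$, with density proportional to $e^{-\pi|x|^2/B^2}$ on $\{|x|\le B\}$ and $0$ elsewhere. A quantum polynomial-time procedure is a sequence, indexed by $\lambda$, of polynomial-size quantum circuits (Pauli $X$, Hadamard, phase $\mathrm{diag}(1,i)$, CNOT and Toffoli gates, ancillas initialised to $|0\rangle$) which take the binary encoding of the input and output one measured bit. A function $\mu$ is negligible if $p(\lambda)\mu(\lambda)\to0$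 for every polynomial $p$. *Assumption $\mathrm{LWE}_{\ell,q,D_{\mathbb Z_q,B_L}}$.* For every function $m'$ of $\lambda$ that is at most a polynomial in $\ell\log q$, every quantum polynomial-time procedure distinguishes $(A,As+e)$ from $(A,u)$ with at most negligible advantage, where $A\in\mathbb Z_q^{m'\times\ell}$, $s\in\mathbb Z_q^{\ell}$, $u\in\mathbb Z_q^{m'}$ are uniform, $e\leftarrow D_{\mathbb Z_q,B_L}^{m'}$, and $A,s,e,u$ are independent. *Key generation.* $\mathrm{GEN}$ samples $A\in\mathbb Z_q^{m\times n}$ from a distribution whose total variation distance to the uniform one is negligible (for instance the output of a trapdoor sampler) and, independently, a uniform $s\in\{0,1\}^n$ and $e\leftarrow D_{\mathbb Z_q,B_V}^{m}$; the key is $(A,As+e)$. *Hardcore bit.* Let $J:\mathbb Z_q^n\to\{0,1\}^w$ write each coordinate in binary through its representative in $\{0,\dots,q-1\}$. For $s\in\{0,1\}^n$ and $d\in\{0,1\}^w$ let $H'_{s,d}\subseteq\{0,1\}$ be the set of all bits $$d\cdot\bigl(J(x)\oplus J(x-(-1)^b s)\bigr)\bmod 2,$$ where $b\in\{0,1\}$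 and $x\in\mathbb Z_q^n$ is such that subtracting $(-1)^bs$ from $x$ does not wrap around modulo $q$: in each coordinate, on representatives in $\{0,\dots,q-1\}$, it is the subtraction of integers. **Statement.** Assume $\mathrm{LWE}_{\ell,q,D_{\mathbb Z_q,B_L}}$. Then for every choice of $\hat d=\hat d_\lambda\in\{0,1\}^n\setminus\{0^n\}$, regarded also as an element of $\mathbb Z_q^n$, and for every quantum polynomial-time procedure $\mathcal A:\mathbb Z_q^{m\times n}\times\mathbb Z_q^m\to\{0,1\}$ there is a negligible function $\mu$ such that for all $\lambda$ $$\Bigl|\Pr_{(A,As+e)\leftarrow\mathrm{GEN}}\bigl[\mathcal A(A,As+e)\in H'_{s,J(\hat d)}\bigr]-\tfrac12\Bigr|\le\mu(\lambda).$$ -/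

import Mathlib

open Filter Topology Asymptotics

noncomputable section

namespace LWE

/-! ### Growth of functions of the security parameter -/

/-- `f` is bounded by a polynomial in the security parameter. -/
def PolyBounded (f : ℕ → ℕ) : Prop :=
  ∃ p : Polynomial ℕ, ∀ k, f k ≤ p.eval k

/-- `μ` is negligible: `k ^ c * μ k → 0` for every `c`. -/
def Negligible (μ : ℕ → ℝ) : Prop :=
  SuperpolynomialDecay atTop (fun k : ℕ => (k : ℝ)) μ

/-- `f` is super-polynomial: `f k / k ^ c → ∞` for every `c`. -/
def SuperPoly (f : ℕ → ℝ) : Prop :=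
  ∀ c : ℕ, Tendsto (fun k : ℕ => f k / (k : ℝ) ^ c) atTop atTop

/-! ### Quantum circuits -/

/-- Gates on a set `W` of wires, one qubit on each: the Pauli gate `X`, the Hadamard gate, the
phase gate `diag(1, i)`, `CNOT` and the Toffoli gate. -/
inductive Gate (W : Type) : Type where
  | X (i : W) : Gate W
  | H (i : W) : Gate W
  | K (i : W) : Gate W
  | CNOT (i j : W) (hij : i ≠ j) : Gate W
  | Toffoli (i j t : W) (hij : i ≠ j) (hit : i ≠ t) (hjt : j ≠ t) : Gate W

/-- The unitary action of a gate on a state vector, given by its amplitudes in the standard basis.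
`X`, `CNOT` and `Toffoli` are involutive permutations of the basis. -/
def Gate.apply {W : Type} [DecidableEq W] : Gate W → ((W → Bool) → ℂ) → ((W → Bool) → ℂ)
  | .X i, ψ => fun b => ψ (Function.update b i (!(b i)))
  | .H i, ψ => fun b => (1 / (Real.sqrt 2 : ℂ)) *
      (ψ (Function.update b i false) +
        (if b i then -1 else 1) * ψ (Function.update b i true))
  | .K i, ψ => fun b => (if b i then Complex.I else 1) * ψ b
  | .CNOT i j _, ψ => fun b => ψ (Function.update b j (xor (b j) (b i)))
  | .Toffoli i j t _ _ _, ψ => fun b => ψ (Function.update b t (xor (b t) (b i && b j)))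

/-- A quantum circuit with classical input wires `ι`, some ancilla wires, a list of gates (applied
from the head of the list on) and an output wire. -/
structure QCircuit (ι : Type) where
  ancillas : ℕ
  gates : List (Gate (ι ⊕ Fin ancillas))
  out : ι ⊕ Fin ancillas

/-- Number of ancillas plus number of gates. -/
def QCircuit.size {ι : Type} (C : QCircuit ι) : ℕ := C.ancillas + C.gates.length

/-- The final state of the circuit started in the basis state `|x, 0…0⟩`. -/
def QCircuit.run {ι : Type} [Fintype ι] [DecidableEq ι] (C : QCircuit ι) (x : ι → Bool) :
    ((ι ⊕ Fin C.ancillas) → Bool) → ℂ :=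
  C.gates.foldl (fun ψ g => g.apply ψ)
    (fun b => if b = Sum.elim x (fun _ => false) then 1 else 0)

open Classical in
/-- The probability that the measured output bit of the circuit on input `x` lies in `S`. -/
def QCircuit.probMem {ι : Type} [Fintype ι] [DecidableEq ι] (C : QCircuit ι) (x : ι → Bool)
    (S : Set Bool) : ℝ :=
  ∑ b : (ι ⊕ Fin C.ancillas) → Bool, if b C.out ∈ S then ‖C.run x b‖ ^ 2 else 0

/-- A quantum polynomial-time procedure on inputs indexed by the security parameter: a sequence of
circuits of polynomially bounded size, one for each value of the security parameter. -/
def IsQPT {ι : ℕ → Type} (C : ∀ k, QCircuit (ι k)) : Prop :=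
  PolyBounded fun k => (C k).size

/-! ### Distributions -/

/-- A probability density on a finite set. -/
def IsDensity {X : Type} [Fintype X] (f : X → ℝ) : Prop :=
  (∀ x, 0 ≤ f x) ∧ ∑ x, f x = 1

/-- Total variation distance. -/
def tvDist {X : Type} [Fintype X] (f g : X → ℝ) : ℝ :=
  (1 / 2) * ∑ x, |f x - g x|

/-- The uniform density. -/
def unif (X : Type) [Fintype X] : X → ℝ := fun _ => 1 / Fintype.card X

/-- The Gaussian weight of `x ∈ ℤ_q`, truncated at absolute value `B`; the absolute value is that of
the representative in `(-q/2, q/2]`. -/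
def gaussWeight (q : ℕ) (B : ℝ) (x : ZMod q) : ℝ :=
  if |(x.valMinAbs : ℝ)| ≤ B then Real.exp (-Real.pi * (x.valMinAbs : ℝ) ^ 2 / B ^ 2) else 0

/-- The density of the truncated discrete Gaussian on `ℤ_q` with parameter `B`. -/
def gauss (q : ℕ) [NeZero q] (B : ℝ) (x : ZMod q) : ℝ :=
  gaussWeight q B x / ∑ y : ZMod q, gaussWeight q B y

/-- The density of `m` independent samples from `χ`. -/
def iidDensity {X : Type} (m : ℕ) (χ : X → ℝ) (e : Fin m → X) : ℝ := ∏ i, χ (e i)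

/-! ### Keys and the LWE assumption -/

/-- Wires carrying a pair in `ℤ_q^{m × n} × ℤ_q^m`, with `⌈log₂ q⌉` bits for each entry. -/
abbrev KeyWires (q m n : ℕ) : Type := ((Fin m × Fin n) ⊕ Fin m) × Fin (Nat.clog 2 q)

/-- The binary encoding of a pair `(A, u)`. -/
def encodeKey {q m n : ℕ} (A : Matrix (Fin m) (Fin n) (ZMod q)) (u : Fin m → ZMod q) :
    KeyWires q m n → Bool :=
  fun w => (Sum.elim (fun ij : Fin m × Fin n => A ij.1 ij.2) u w.1).val.testBit w.2

/-- Probability that `C` outputs `1` on `(A, A s + e)`, for uniform `A ∈ ℤ_q^{m × ℓ}`, uniform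
`s ∈ ℤ_q^ℓ` and `e ← χ^m`. -/
def probLWE {q m ℓ : ℕ} [NeZero q] (χ : ZMod q → ℝ) (C : QCircuit (KeyWires q m ℓ)) : ℝ :=
  ∑ A : Matrix (Fin m) (Fin ℓ) (ZMod q), ∑ s : Fin ℓ → ZMod q, ∑ e : Fin m → ZMod q,
    unif _ A * unif _ s * iidDensity m χ e * C.probMem (encodeKey A (A.mulVec s + e)) {true}

/-- Probability that `C` outputs `1` on `(A, u)`, for uniform `A` and `u`. -/
def probUnif {q m ℓ : ℕ} [NeZero q] (C : QCircuit (KeyWires q m ℓ)) : ℝ :=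
  ∑ A : Matrix (Fin m) (Fin ℓ) (ZMod q), ∑ u : Fin m → ZMod q,
    unif _ A * unif _ u * C.probMem (encodeKey A u) {true}

/-- The `LWE_{ℓ,q,χ}` assumption: for every number `m` of samples that is at most a polynomial in
`ℓ log q`, every quantum polynomial-time procedure has negligible distinguishing advantage. -/
def LWEHard (ℓ q : ℕ → ℕ) [∀ k, NeZero (q k)] (χ : ∀ k, ZMod (q k) → ℝ) : Prop :=
  ∀ m : ℕ → ℕ,
    (∃ p : Polynomial ℝ, ∀ k, (m k : ℝ) ≤ p.eval ((ℓ k : ℝ) * Real.logb 2 (q k))) →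
    ∀ C : ∀ k, QCircuit (KeyWires (q k) (m k) (ℓ k)), IsQPT C →
      ∃ μ : ℕ → ℝ, Negligible μ ∧ ∀ k, |probLWE (χ k) (C k) - probUnif (C k)| ≤ μ k

/-! ### Parameters -/

/-- The conditions on the parameters. All logarithms are to base `2`. -/
structure ParamConditions (C_T : ℝ) (q ℓ n m B_L B_V : ℕ → ℕ) (B_P : ℕ → ℝ) : Prop where
  q_prime : ∀ k, (q k).Prime
  one_le_ℓ : ∀ k, 1 ≤ ℓ k
  one_le_n : ∀ k, 1 ≤ n k
  one_le_m : ∀ k, 1 ≤ m k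
  one_le_B_L : ∀ k, 1 ≤ B_L k
  poly_ℓ : PolyBounded ℓ
  poly_n : PolyBounded n
  poly_m : PolyBounded m
  poly_w : PolyBounded fun k => n k * Nat.clog 2 (q k)
  n_large : ∃ c : ℝ, 1 < c ∧ ∀ᶠ k in atTop, c * (ℓ k * Real.logb 2 (q k)) ≤ n k
  m_large : ∃ c : ℝ, 0 < c ∧ ∀ᶠ k in atTop, c * (n k * Real.logb 2 (q k)) ≤ m k
  B_P_eq : ∀ k, B_P k = q k / (2 * C_T * Real.sqrt (m k * n k * Real.logb 2 (q k)))
  le_B_L : ∀ k, 2 * Real.sqrt (n k) ≤ B_L k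
  B_L_lt : ∀ k, B_L k < B_V k
  B_V_lt : ∀ k, (B_V k : ℝ) < B_P k
  ratio_PV : SuperPoly fun k => B_P k / B_V k
  ratio_VL : SuperPoly fun k => (B_V k : ℝ) / B_L k

/-! ### The hardcore bit -/

/-- A string `s ∈ {0,1}^n` as an element of `ℤ_q^n`. -/
def bitsToZMod (q : ℕ) {n : ℕ} (s : Fin n → Bool) : Fin n → ZMod q :=
  fun i => if s i then 1 else 0

/-- `x - (-1)^b s` in `ℤ_q^n`. -/
def shift {q n : ℕ} (b : Bool) (s : Fin n → Bool) (x : Fin n → ZMod q) : Fin n → ZMod q :=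
  x - (-1 : ZMod q) ^ b.toNat • bitsToZMod q s

/-- The binary representation `J : ℤ_q^n → {0,1}^w`, `w = n ⌈log₂ q⌉`: each coordinate is written in
binary through its representative in `{0, …, q - 1}`, least significant bit first. -/
def J {q n : ℕ} (x : Fin n → ZMod q) : Fin n × Fin (Nat.clog 2 q) → Bool :=
  fun ij => (x ij.1).val.testBit ij.2

/-- Bitwise exclusive or. -/
def xorStr {ι : Type} (y z : ι → Bool) : ι → Bool := fun i => xor (y i) (z i)

/-- The inner product modulo `2` of two bit strings. -/
def dotBit {ι : Type} [Fintype ι] (y z : ι → Bool) : Bool :=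
  decide ((∑ i, (y i && z i).toNat) % 2 = 1)

/-- Subtracting `(-1)^b s` from `x` does not wrap around modulo `q`: on the representatives in
`{0, …, q - 1}` it is the subtraction of integers. -/
def NoWrap {q n : ℕ} (b : Bool) (s : Fin n → Bool) (x : Fin n → ZMod q) : Prop :=
  ∀ i, ((shift b s x i).val : ℤ) = (x i).val - (-1) ^ b.toNat * (s i).toNat

/-- The set `H'_{s,d}` of the bits `d · (J(x) ⊕ J(x - (-1)^b s))`. -/
def hardcoreSet (q : ℕ) {n : ℕ} (s : Fin n → Bool)
    (d : Fin n × Fin (Nat.clog 2 q) → Bool) : Set Bool :=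
  {c | ∃ (b : Bool) (x : Fin n → ZMod q),
    NoWrap b s x ∧ c = dotBit d (xorStr (J x) (J (shift b s x)))}

/-- The probability that `C (A, A s + e) ∈ H'_{s,d}` when the key is generated as follows: `A` is
drawn from the density `P`, `s` uniformly from `{0,1}^n`, and `e` from the `m`-dimensional truncated
discrete Gaussian with parameter `B`. -/
def probHardcore {q m n : ℕ} [NeZero q] (P : Matrix (Fin m) (Fin n) (ZMod q) → ℝ) (B : ℝ)
    (d : Fin n × Fin (Nat.clog 2 q) → Bool) (C : QCircuit (KeyWires q m n)) : ℝ :=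
  ∑ A : Matrix (Fin m) (Fin n) (ZMod q), ∑ s : Fin n → Bool, ∑ e : Fin m → ZMod q,
    P A * unif _ s * iidDensity m (gauss q B) e *
      C.probMem (encodeKey A (A.mulVec (bitsToZMod q s) + e)) (hardcoreSet q s d)

end LWE

end

/-! The hardcore set is the single bit d̂·s. As d̂ has entries 0 and 1, `J` of it is supported on
least significant bits, and a subtraction without wrap-around changes the parity of coordinate i
exactly when s_i = 1 (`hardcoreSet_J`). So the quantity to bound is the correlation of the balanced
sign (-1)^(d̂·s) with the bias of the circuit on (A, As + e) (`probHardcore_sub_half`).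

For uniform A, this correlation barely changes when A is replaced by a lossy matrix BC + F, with B
uniform m×ℓ, C uniform ℓ×n and F Gaussian of the intermediate width √(B_L B_V). Then As + e = B(Cs)
+ Fs + e. The much wider e floods Fs, so s enters only through Cs, a subset sum of n uniform
elements of ℤ_q^ℓ. Since 2^n exceeds q^ℓ by a positive power of q, a second-moment leftover hash
lemma, weighted by the sign, shows that the sign is hidden (`Ex_sum_abs_subsetSum_le`,
`abs_hybridEx_last_le`).

The columns of A are made lossy one at a time (`abs_hybridEx_sub_succ_le`). LWE does not apply
directly: m need not be polynomial in ℓ log q, and the given errors have width B_L.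
`LWEBound.amplify` turns 3ℓ⌈log q⌉ samples into m wider ones: it takes random subset sums, close to
uniform by leftover hashing, and adds fresh noise that floods the summed errors. Up to polynomial
factors, both floodings cost √(B_L / B_V), which is negligible.

For fixed values of its randomness, each reduction is an affine map over ℤ_q applied to the
challenge. Circuits are non-uniform, so the constants are hardwired
(`QCircuit.exists_precompose_affine`), and taking the worst affine map at each security parameter
gives one negligible bound for all of them (`LWEHard.exists_negligible_affine`). -/

noncomputable section

namespace LWE

/-! ### Circuits: norm preservation, relabelling of wires, classical gates -/

/-- The state obtained by applying a list of gates. -/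
def runGates {W : Type} [DecidableEq W] (gs : List (Gate W)) (ψ : (W → Bool) → ℂ) :
    (W → Bool) → ℂ :=
  gs.foldl (fun ψ g => g.apply ψ) ψ

/-- The standard basis state of a bit assignment. -/
def basisState {W : Type} (x : W → Bool) : (W → Bool) → ℂ :=
  open Classical in fun b => if b = x then 1 else 0

lemma update_xor_involutive {W : Type} [DecidableEq W] (t : W) (c : (W → Bool) → Bool)
    (hc : ∀ b v, c (Function.update b t v) = c b) :
    Function.Involutive fun b : W → Bool => Function.update b t (xor (b t) (c b)) := by
  intro b
  simp [hc]

/-- The permutation of the basis by a controlled negation. -/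
def xorPerm {W : Type} [DecidableEq W] (t : W) (c : (W → Bool) → Bool)
    (hc : ∀ b v, c (Function.update b t v) = c b) : Equiv.Perm (W → Bool) :=
  (update_xor_involutive t c hc).toPerm

lemma sum_norm_xor {W : Type} [DecidableEq W] [Fintype W] (t : W) (c : (W → Bool) → Bool)
    (hc : ∀ b v, c (Function.update b t v) = c b) (ψ : (W → Bool) → ℂ) :
    ∑ b, ‖ψ (Function.update b t (xor (b t) (c b)))‖ ^ 2 = ∑ b, ‖ψ b‖ ^ 2 :=
  Equiv.sum_comp (xorPerm t c hc) fun b => ‖ψ b‖ ^ 2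

/-- Pairs the assignments that differ in bit `i`, the pairs whose amplitudes a Hadamard gate mixes.
-/
lemma sum_split_bit {W : Type} [DecidableEq W] [Fintype W] (i : W) (f : (W → Bool) → ℝ) :
    2 * ∑ b, f b = ∑ b, (f (Function.update b i false) + f (Function.update b i true)) := by
  have h1 : ∑ b, f (Function.update b i (xor (b i) true)) = ∑ b, f b :=
    Equiv.sum_comp (xorPerm i (fun _ => true) fun _ _ => rfl) f
  rw [two_mul]
  nth_rewrite 2 [← h1]
  rw [← Finset.sum_add_distrib]
  refine Finset.sum_congr rfl fun b _ => ?_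
  cases hb : b i
  · rw [show f b = f (Function.update b i false) by rw [← hb, Function.update_eq_self]]
    simp
  · rw [show f b = f (Function.update b i true) by rw [← hb, Function.update_eq_self]]
    simp [add_comm]

lemma hadamard_norm (a b : ℂ) :
    ‖(1 / (Real.sqrt 2 : ℂ)) * (a + 1 * b)‖ ^ 2 + ‖(1 / (Real.sqrt 2 : ℂ)) * (a + (-1) * b)‖ ^ 2 =
      ‖a‖ ^ 2 + ‖b‖ ^ 2 := by
  have h := parallelogram_law_with_norm ℝ a b
  have h2 : ‖(1 / (Real.sqrt 2 : ℂ))‖ ^ 2 = 1 / 2 := by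
    rw [norm_div, norm_one, Complex.norm_real, Real.norm_of_nonneg (Real.sqrt_nonneg 2), div_pow,
      Real.sq_sqrt (by norm_num)]
    norm_num
  rw [norm_mul, norm_mul, mul_pow, mul_pow, h2, one_mul, neg_one_mul, ← sub_eq_add_neg]
  nlinarith

lemma Gate.sum_norm_apply {W : Type} [DecidableEq W] [Fintype W] (g : Gate W)
    (ψ : (W → Bool) → ℂ) : ∑ b, ‖g.apply ψ b‖ ^ 2 = ∑ b, ‖ψ b‖ ^ 2 := by
  cases g with
  | X i =>
    have := sum_norm_xor i (fun _ => true) (fun _ _ => rfl) ψ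
    simpa [Gate.apply] using this
  | H i =>
    have h1 := sum_split_bit i fun b => ‖(Gate.H i).apply ψ b‖ ^ 2
    have h2 := sum_split_bit i fun b => ‖ψ b‖ ^ 2
    have h3 : ∀ b, ‖(Gate.H i).apply ψ (Function.update b i false)‖ ^ 2 +
        ‖(Gate.H i).apply ψ (Function.update b i true)‖ ^ 2 =
        ‖ψ (Function.update b i false)‖ ^ 2 + ‖ψ (Function.update b i true)‖ ^ 2 := by
      intro b
      refine Eq.trans ?_ (hadamard_norm _ _)
      simp only [Gate.apply, Function.update_idem, Function.update_self, if_true,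
        Bool.false_eq_true, if_false]
    rw [Finset.sum_congr rfl fun b _ => h3 b] at h1
    linarith
  | K i =>
    refine Finset.sum_congr rfl fun b _ => ?_
    simp only [Gate.apply, norm_mul]
    split <;> simp
  | CNOT i j hij =>
    exact sum_norm_xor j (fun b => b i) (fun b v => by simp [Function.update_of_ne hij]) ψ
  | Toffoli i j t hij hit hjt =>
    exact sum_norm_xor t (fun b => b i && b j)
      (fun b v => by simp [Function.update_of_ne hit, Function.update_of_ne hjt]) ψ

lemma sum_norm_runGates {W : Type} [DecidableEq W] [Fintype W] (gs : List (Gate W))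
    (ψ : (W → Bool) → ℂ) : ∑ b, ‖runGates gs ψ b‖ ^ 2 = ∑ b, ‖ψ b‖ ^ 2 := by
  induction gs generalizing ψ with
  | nil => rfl
  | cons g gs ih => exact (ih _).trans (g.sum_norm_apply ψ)

lemma sum_norm_basisState {W : Type} [Fintype W] [DecidableEq W] (x : W → Bool) :
    ∑ b, ‖basisState x b‖ ^ 2 = 1 := by
  classical
  simp [basisState, apply_ite, ite_pow]

lemma QCircuit.run_eq {ι : Type} [Fintype ι] [DecidableEq ι] (C : QCircuit ι) (x : ι → Bool) :
    C.run x = runGates C.gates (basisState (Sum.elim x fun _ => false)) := by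
  unfold QCircuit.run runGates basisState
  congr 1
  funext b
  congr

lemma QCircuit.sum_norm_run {ι : Type} [Fintype ι] [DecidableEq ι] (C : QCircuit ι)
    (x : ι → Bool) : ∑ b, ‖C.run x b‖ ^ 2 = 1 := by
  rw [C.run_eq, sum_norm_runGates, sum_norm_basisState]

lemma QCircuit.probMem_nonneg {ι : Type} [Fintype ι] [DecidableEq ι] (C : QCircuit ι)
    (x : ι → Bool) (S : Set Bool) : 0 ≤ C.probMem x S := by
  unfold QCircuit.probMem
  exact Finset.sum_nonneg fun b _ => by split <;> positivity

lemma QCircuit.probMem_false_add_true {ι : Type} [Fintype ι] [DecidableEq ι] (C : QCircuit ι)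
    (x : ι → Bool) : C.probMem x {false} + C.probMem x {true} = 1 := by
  rw [← C.sum_norm_run x]
  unfold QCircuit.probMem
  rw [← Finset.sum_add_distrib]
  refine Finset.sum_congr rfl fun b _ => ?_
  cases b C.out <;> simp

/-- Relabelling the wires of a gate. -/
def Gate.map {W W' : Type} (f : W → W') (hf : Function.Injective f) : Gate W → Gate W'
  | .X i => .X (f i)
  | .H i => .H (f i)
  | .K i => .K (f i)
  | .CNOT i j h => .CNOT (f i) (f j) (hf.ne h)
  | .Toffoli i j t h1 h2 h3 => .Toffoli (f i) (f j) (f t) (hf.ne h1) (hf.ne h2) (hf.ne h3)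

open Classical in
/-- A state on the wires in the range of `f`, with the other wires in the basis state `r`. -/
def liftState {W W' : Type} (f : W → W') (r : W' → Bool) (ψ : (W → Bool) → ℂ) :
    (W' → Bool) → ℂ :=
  fun b => if ∀ w, w ∉ Set.range f → b w = r w then ψ (b ∘ f) else 0

lemma liftState_update {W W' : Type} [DecidableEq W] [DecidableEq W'] (f : W → W')
    (hf : Function.Injective f) (r : W' → Bool) (ψ : (W → Bool) → ℂ) (b : W' → Bool) (i : W)
    (v : Bool) :
    liftState f r ψ (Function.update b (f i) v) =
      liftState f r (fun c => ψ (Function.update c i v)) b := by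
  classical
  unfold liftState
  rw [Function.update_comp_eq_of_injective b hf]
  refine if_congr (forall_congr' fun w => imp_congr_right fun hw => ?_) rfl rfl
  rw [Function.update_of_ne]
  rintro rfl
  exact hw ⟨i, rfl⟩

lemma Gate.map_apply_liftState {W W' : Type} [DecidableEq W] [DecidableEq W'] (f : W → W')
    (hf : Function.Injective f) (r : W' → Bool) (g : Gate W) (ψ : (W → Bool) → ℂ) :
    (g.map f hf).apply (liftState f r ψ) = liftState f r (g.apply ψ) := by
  funext b
  cases g <;> simp only [Gate.map, Gate.apply, liftState_update f hf] <;>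
    simp only [liftState, Function.comp] <;> split <;> simp

lemma runGates_map_liftState {W W' : Type} [DecidableEq W] [DecidableEq W'] (f : W → W')
    (hf : Function.Injective f) (r : W' → Bool) (gs : List (Gate W)) (ψ : (W → Bool) → ℂ) :
    runGates (gs.map (Gate.map f hf)) (liftState f r ψ) = liftState f r (runGates gs ψ) := by
  induction gs generalizing ψ with
  | nil => rfl
  | cons g gs ih =>
    simp only [runGates, List.map_cons, List.foldl_cons, Gate.map_apply_liftState] at ih ⊢
    exact ih _

lemma basisState_eq_liftState {W W' : Type} (f : W → W') (y : W' → Bool) :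
    basisState y = liftState f y (basisState (y ∘ f)) := by
  classical
  funext b
  unfold basisState liftState
  by_cases h : b = y
  · subst h
    simp
  · rw [if_neg h]
    by_cases h1 : ∀ w, w ∉ Set.range f → b w = y w
    · rw [if_pos h1]
      refine (if_neg fun h2 => h (funext fun w => ?_)).symm
      by_cases hw : w ∈ Set.range f
      · obtain ⟨i, rfl⟩ := hw
        exact congrFun h2 i
      · exact h1 w hw
    · rw [if_neg h1]

/-- A lifted state lives on the assignments that agree with `r` off the range of `f`, and
`Function.extend` identifies these with assignments on `W`. Spectator wires in a basis state thus
leave measurement statistics unchanged. -/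
lemma sum_liftState {W W' : Type} [Fintype W] [Fintype W'] [DecidableEq W] [DecidableEq W']
    (f : W → W') (hf : Function.Injective f) (r : W' → Bool) (ψ : (W → Bool) → ℂ)
    (p : (W → Bool) → Prop) [DecidablePred p] :
    ∑ b : W' → Bool, (if p (b ∘ f) then ‖liftState f r ψ b‖ ^ 2 else 0) =
      ∑ b : W → Bool, if p b then ‖ψ b‖ ^ 2 else 0 := by
  classical
  symm
  refine Finset.sum_of_injOn (fun b : W → Bool => Function.extend f b r) ?_ ?_ ?_ ?_
  · intro b _ c _ h
    have := congrArg (· ∘ f) h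
    simpa [Function.extend_comp hf] using this
  · intro b _
    simp
  · intro b _ hb
    have : liftState f r ψ b = 0 := by
      unfold liftState
      rw [if_neg]
      intro h
      refine hb ⟨b ∘ f, by simp, ?_⟩
      funext w
      by_cases hw : w ∈ Set.range f
      · obtain ⟨i, rfl⟩ := hw
        simp [hf.extend_apply]
      · simp only [Function.extend_apply' _ _ _ hw, h w hw]
    simp [this]
  · intro b _
    have h : liftState f r ψ (Function.extend f b r) = ψ b := by
      unfold liftState
      rw [if_pos, Function.extend_comp hf]
      intro w hw
      exact Function.extend_apply' _ _ _ hw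
    simp only [h, Function.extend_comp hf]

/-! ### Classical gates on basis states -/

lemma apply_basisState_perm {W : Type} (σ : (W → Bool) → (W → Bool))
    (hσ : Function.Involutive σ) (x : W → Bool) :
    (fun b => basisState x (σ b)) = basisState (σ x) := by
  funext b
  classical
  unfold basisState
  exact if_congr hσ.eq_iff rfl rfl

lemma apply_X_basisState {W : Type} [DecidableEq W] (t : W) (x : W → Bool) :
    (Gate.X t).apply (basisState x) = basisState (Function.update x t (!(x t))) := by
  have h := update_xor_involutive t (fun _ => true) fun _ _ => rfl
  simp only [Bool.xor_true] at h
  exact apply_basisState_perm _ h x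

lemma apply_CNOT_basisState {W : Type} [DecidableEq W] (i t : W) (h : i ≠ t) (x : W → Bool) :
    (Gate.CNOT i t h).apply (basisState x) =
      basisState (Function.update x t (xor (x t) (x i))) :=
  apply_basisState_perm _ (update_xor_involutive t (fun b => b i) fun b v => by
    simp [Function.update_of_ne h]) x

lemma apply_Toffoli_basisState {W : Type} [DecidableEq W] (i j t : W) (hij : i ≠ j) (hit : i ≠ t)
    (hjt : j ≠ t) (x : W → Bool) :
    (Gate.Toffoli i j t hij hit hjt).apply (basisState x) =
      basisState (Function.update x t (xor (x t) (x i && x j))) :=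
  apply_basisState_perm _ (update_xor_involutive t (fun b => b i && b j) fun b v => by
    simp [Function.update_of_ne hit, Function.update_of_ne hjt]) x

/-! ### Straight-line programs -/

/-- `f` is an input bit or an entry of `l`. -/
def Avail {ι : Type} (l : List ((ι → Bool) → Bool)) (f : (ι → Bool) → Bool) : Prop :=
  f ∈ l ∨ ∃ i, f = fun x => x i

/-- `l` is the list of intermediate results of a Boolean straight-line program. -/
inductive Straight {ι : Type} : List ((ι → Bool) → Bool) → Prop
  | nil : Straight []
  | one {l : List ((ι → Bool) → Bool)} : Straight l → Straight (l ++ [fun _ => true])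
  | andGate {l : List ((ι → Bool) → Bool)} {f g : (ι → Bool) → Bool} :
      Straight l → Avail l f → Avail l g → Straight (l ++ [fun x => f x && g x])
  | xorGate {l : List ((ι → Bool) → Bool)} {f g : (ι → Bool) → Bool} :
      Straight l → Avail l f → Avail l g → Straight (l ++ [fun x => xor (f x) (g x)])

/-- The wire contents after a straight-line program with intermediate results `l`. -/
def slpState {ι : Type} {N : ℕ} (l : List ((ι → Bool) → Bool)) (x : ι → Bool) :
    ι ⊕ Fin N → Bool :=
  Sum.elim x fun j => l.getD j (fun _ => false) x

lemma Avail.exists_wire {ι : Type} {N : ℕ} {l : List ((ι → Bool) → Bool)}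
    {f : (ι → Bool) → Bool} (h : Avail l f) (hN : l.length < N) :
    ∃ w : ι ⊕ Fin N, w ≠ Sum.inr ⟨l.length, hN⟩ ∧ ∀ x, slpState l x w = f x := by
  rcases h with h | ⟨i, rfl⟩
  · obtain ⟨t, ht, rfl⟩ := List.mem_iff_getElem.1 h
    refine ⟨Sum.inr ⟨t, ht.trans hN⟩, ?_, fun x => ?_⟩
    · simp [ht.ne]
    · simp [slpState, ht]
  · exact ⟨Sum.inl i, by simp, fun x => rfl⟩

lemma slpState_append {ι : Type} [DecidableEq ι] {N : ℕ} (l : List ((ι → Bool) → Bool))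
    (f : (ι → Bool) → Bool) (x : ι → Bool) (hN : l.length < N) :
    slpState (N := N) (l ++ [f]) x =
      Function.update (slpState l x) (Sum.inr ⟨l.length, hN⟩) (f x) := by
  funext w
  rcases w with i | j
  · simp [slpState]
  · by_cases hj : j = ⟨l.length, hN⟩
    · subst hj
      simp [slpState]
    · rw [Function.update_of_ne (by simpa using hj)]
      simp only [slpState, Sum.elim_inr]
      have hj' : (j : ℕ) ≠ l.length := fun h => hj (Fin.ext h)
      rcases lt_or_gt_of_ne hj' with h | h
      · rw [List.getD_append _ _ _ _ h]
      · rw [List.getD_eq_default _ _ (by simp; omega), List.getD_eq_default _ _ h.le]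

lemma slpState_fresh {ι : Type} {N : ℕ} (l : List ((ι → Bool) → Bool)) (x : ι → Bool)
    (hN : l.length < N) : slpState (N := N) l x (Sum.inr ⟨l.length, hN⟩) = false := by
  simp [slpState]

/-- Each step writes its result on the next ancilla, which still holds 0. An exclusive or takes two
gates, hence the factor 2. -/
lemma Straight.exists_gates {ι : Type} [DecidableEq ι] {N : ℕ} {l : List ((ι → Bool) → Bool)}
    (hl : Straight l) (hN : l.length ≤ N) :
    ∃ gs : List (Gate (ι ⊕ Fin N)), gs.length ≤ 2 * l.length ∧
      ∀ x, runGates gs (basisState (Sum.elim x fun _ => false)) = basisState (slpState l x) := by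
  induction hl with
  | nil => exact ⟨[], by simp, fun x => by simp [runGates, slpState]⟩
  | @one l _ ih =>
    have hN' : l.length < N := by simp at hN; omega
    obtain ⟨gs, h1, h2⟩ := ih hN'.le
    refine ⟨gs ++ [Gate.X (Sum.inr ⟨l.length, hN'⟩)], by simp; omega, fun x => ?_⟩
    have := h2 x
    simp only [runGates, List.foldl_append, List.foldl_cons, List.foldl_nil] at this ⊢
    rw [this, apply_X_basisState, slpState_append _ _ _ hN', slpState_fresh]
    rfl
  | @andGate l f g _ hf hg ih =>
    have hN' : l.length < N := by simp at hN; omega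
    obtain ⟨gs, h1, h2⟩ := ih hN'.le
    obtain ⟨u, hu, hfu⟩ := hf.exists_wire hN'
    obtain ⟨v, hv, hgv⟩ := hg.exists_wire hN'
    -- A Toffoli gate needs distinct controls. If both operands sit on one wire, the conjunction is
    -- a copy, made by a CNOT.
    by_cases huv : u = v
    · refine ⟨gs ++ [Gate.CNOT u _ hu], by simp; omega, fun x => ?_⟩
      have := h2 x
      simp only [runGates, List.foldl_append, List.foldl_cons, List.foldl_nil] at this ⊢
      rw [this, apply_CNOT_basisState, slpState_append _ _ _ hN', slpState_fresh, ← hfu, ← hgv,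
        huv]
      simp
    · refine ⟨gs ++ [Gate.Toffoli u v _ huv hu hv], by simp; omega, fun x => ?_⟩
      have := h2 x
      simp only [runGates, List.foldl_append, List.foldl_cons, List.foldl_nil] at this ⊢
      rw [this, apply_Toffoli_basisState, slpState_append _ _ _ hN', slpState_fresh, hfu, hgv]
      simp
  | @xorGate l f g _ hf hg ih =>
    have hN' : l.length < N := by simp at hN; omega
    obtain ⟨gs, h1, h2⟩ := ih hN'.le
    obtain ⟨u, hu, hfu⟩ := hf.exists_wire hN'
    obtain ⟨v, hv, hgv⟩ := hg.exists_wire hN'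
    refine ⟨gs ++ [Gate.CNOT u _ hu, Gate.CNOT v _ hv], by simp; omega, fun x => ?_⟩
    have := h2 x
    simp only [runGates, List.foldl_append, List.foldl_cons, List.foldl_nil] at this ⊢
    rw [this, apply_CNOT_basisState, apply_CNOT_basisState, slpState_append _ _ _ hN',
      slpState_fresh, Function.update_of_ne hv, hfu, hgv]
    simp

lemma Avail.mono {ι : Type} {l l' : List ((ι → Bool) → Bool)} {f : (ι → Bool) → Bool}
    (h : Avail l f) (hl : l <+: l') : Avail l' f :=
  h.imp_left fun hm => hl.subset hm

/-- A copy is the conjunction of a bit with itself. -/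
lemma Straight.append_copies {ι : Type} {l : List ((ι → Bool) → Bool)} (hl : Straight l)
    (l' : List ((ι → Bool) → Bool)) (h : ∀ f ∈ l', Avail l f) : Straight (l ++ l') := by
  induction l' using List.reverseRecOn with
  | nil => simpa using hl
  | append_singleton l' f ih =>
    have hf : Avail (l ++ l') f := (h f (by simp)).mono (List.prefix_append _ _)
    have := (ih fun g hg => h g (by simp [hg])).andGate hf hf
    simpa [List.append_assoc] using this

/-- Precomposing a quantum circuit with a function computed by a straight-line program. -/
theorem QCircuit.exists_precompose {ι κ : Type} [Fintype ι] [DecidableEq ι] [Fintype κ]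
    [DecidableEq κ] (C : QCircuit κ) {l : List ((ι → Bool) → Bool)} (hl : Straight l)
    (F : (ι → Bool) → κ → Bool) (hF : ∀ k, Avail l fun x => F x k) :
    ∃ C' : QCircuit ι, C'.size ≤ C.size + 3 * (l.length + Fintype.card κ) ∧
      ∀ x S, C'.probMem x S = C.probMem (F x) S := by
  classical
  set K := Fintype.card κ
  let e : κ ≃ Fin K := Fintype.equivFin κ
  -- The outputs are copied to fresh ancillas, so that the inputs of `C` occupy distinct wires even
  -- if `F` repeats a bit or passes an input through. Zeroed ancillas for `C` follow the copies.
  -- Nothing is uncomputed: on a classical input the leftover wires stay in a basis state.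
  set l₂ : List ((ι → Bool) → Bool) := l ++ List.ofFn fun k : Fin K => fun x => F x (e.symm k)
  have hl₂ : Straight l₂ := hl.append_copies _ fun f hf => by
    obtain ⟨k, rfl⟩ := List.mem_ofFn.1 hf
    exact hF _
  have hlen : l₂.length = l.length + K := by simp [l₂]
  set N := l.length + K + C.ancillas
  obtain ⟨gs, hgs, hrun⟩ := hl₂.exists_gates (N := N) (by omega)
  let f : κ ⊕ Fin C.ancillas → ι ⊕ Fin N :=
    Sum.elim (fun k => Sum.inr ⟨l.length + e k, by have := (e k).2; omega⟩)
      fun j => Sum.inr ⟨l.length + K + j, by have := j.2; omega⟩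
  have hf : Function.Injective f := by
    rintro (k | j) (k' | j') h
    · simp only [f, Sum.elim_inl, Sum.inr.injEq, Fin.mk.injEq] at h
      have : e k = e k' := Fin.ext (by omega)
      rw [e.injective this]
    · simp only [f, Sum.elim_inl, Sum.elim_inr, Sum.inr.injEq, Fin.mk.injEq] at h
      have := (e k).2
      omega
    · simp only [f, Sum.elim_inl, Sum.elim_inr, Sum.inr.injEq, Fin.mk.injEq] at h
      have := (e k').2
      omega
    · simp only [f, Sum.elim_inr, Sum.inr.injEq, Fin.mk.injEq] at h
      rw [Fin.ext (show (j : ℕ) = j' by omega)]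
  have hstate : ∀ x, slpState (N := N) l₂ x ∘ f = Sum.elim (F x) fun _ => false := by
    intro x
    funext w
    rcases w with k | j
    · simp [f, slpState, l₂]
    · simp only [Function.comp, f, slpState, Sum.elim_inr]
      rw [List.getD_eq_default _ _ (by omega)]
  refine ⟨⟨N, gs ++ C.gates.map (Gate.map f hf), f C.out⟩, ?_, fun x S => ?_⟩
  · simp only [QCircuit.size, List.length_append, List.length_map]
    omega
  · have h1 : QCircuit.run ⟨N, gs ++ C.gates.map (Gate.map f hf), f C.out⟩ x =
        liftState f (slpState l₂ x) (C.run (F x)) := by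
      rw [QCircuit.run_eq, QCircuit.run_eq, ← hstate, ← runGates_map_liftState f hf,
        ← basisState_eq_liftState, ← hrun]
      simp only [runGates, List.foldl_append]
    unfold QCircuit.probMem
    rw [h1]
    exact sum_liftState f hf _ _ fun b => b C.out ∈ S

/-! ### Boolean straight-line programs for modular arithmetic -/

/-- `l₂` is a straight-line program that extends `l` by at most `N` steps. -/
def Extends {ι : Type} (l l₂ : List ((ι → Bool) → Bool)) (N : ℕ) : Prop :=
  l <+: l₂ ∧ Straight l₂ ∧ l₂.length ≤ l.length + N

lemma Extends.trans {ι : Type} {l₁ l₂ l₃ : List ((ι → Bool) → Bool)} {M N : ℕ}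
    (h : Extends l₁ l₂ M) (h' : Extends l₂ l₃ N) : Extends l₁ l₃ (M + N) :=
  ⟨h.1.trans h'.1, h'.2.1, by have := h.2.2; have := h'.2.2; omega⟩

lemma Extends.mono {ι : Type} {l₁ l₂ : List ((ι → Bool) → Bool)} {M N : ℕ}
    (h : Extends l₁ l₂ M) (hN : M ≤ N) : Extends l₁ l₂ N :=
  ⟨h.1, h.2.1, by have := h.2.2; omega⟩

lemma Extends.refl {ι : Type} {l : List ((ι → Bool) → Bool)} (hl : Straight l) :
    Extends l l 0 :=
  ⟨List.prefix_rfl, hl, by omega⟩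

lemma Straight.exists_xor {ι : Type} {l : List ((ι → Bool) → Bool)} (hl : Straight l)
    {f g : (ι → Bool) → Bool} (hf : Avail l f) (hg : Avail l g) :
    ∃ l₂, Extends l l₂ 1 ∧ Avail l₂ fun x => xor (f x) (g x) :=
  ⟨_, ⟨List.prefix_append _ _, hl.xorGate hf hg, by simp⟩, Or.inl (by simp)⟩

lemma Straight.exists_and {ι : Type} {l : List ((ι → Bool) → Bool)} (hl : Straight l)
    {f g : (ι → Bool) → Bool} (hf : Avail l f) (hg : Avail l g) :
    ∃ l₂, Extends l l₂ 1 ∧ Avail l₂ fun x => f x && g x :=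
  ⟨_, ⟨List.prefix_append _ _, hl.andGate hf hg, by simp⟩, Or.inl (by simp)⟩

lemma exists_consts (ι : Type) : ∃ l : List ((ι → Bool) → Bool),
    Straight l ∧ l.length ≤ 2 ∧ Avail l (fun _ => false) ∧ Avail l fun _ => true := by
  have h1 := (Straight.nil (ι := ι)).one
  have h2 : Avail ([] ++ [fun _ : ι → Bool => true]) fun _ => true := Or.inl (by simp)
  obtain ⟨l, hl, hf⟩ := h1.exists_xor h2 h2
  exact ⟨l, hl.2.1, hl.2.2, by simpa using hf, h2.mono hl.1⟩

/-- The carry into position `i` in the addition of `y` and `z`. -/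
def addCarry (i y z : ℕ) : Bool := decide (2 ^ i ≤ y % 2 ^ i + z % 2 ^ i)

lemma addCarry_eq (i w y z : ℕ) (hw : i ≤ w) :
    BitVec.carry i (BitVec.ofNat w y) (BitVec.ofNat w z) false = addCarry i y z := by
  simp [BitVec.carry, addCarry, Nat.mod_mod_of_dvd _ (pow_dvd_pow 2 hw)]

lemma testBit_add_eq (i y z : ℕ) :
    (y + z).testBit i = xor (y.testBit i) (xor (z.testBit i) (addCarry i y z)) := by
  have h := BitVec.getLsbD_add (w := i + 1) (Nat.lt_succ_self i) (BitVec.ofNat _ y)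
    (BitVec.ofNat _ z)
  rw [addCarry_eq _ _ _ _ (Nat.le_succ i), ← BitVec.ofNat_add] at h
  simpa only [BitVec.getLsbD_ofNat, Nat.lt_succ_self, decide_true, Bool.true_and] using h

lemma addCarry_succ (i y z : ℕ) :
    addCarry (i + 1) y z = xor (y.testBit i && z.testBit i)
      (addCarry i y z && xor (y.testBit i) (z.testBit i)) := by
  rw [← addCarry_eq (i + 1) (i + 1) _ _ le_rfl, BitVec.carry_succ,
    addCarry_eq _ _ _ _ (Nat.le_succ i)]
  simp only [BitVec.getLsbD_ofNat, Nat.lt_succ_self, decide_true, Bool.true_and,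
    Bool.atLeastTwo]
  cases y.testBit i <;> cases z.testBit i <;> cases addCarry i y z <;> rfl

/-- The low `L` bits of `Y` are available. -/
def AvailNat {ι : Type} (l : List ((ι → Bool) → Bool)) (L : ℕ) (Y : (ι → Bool) → ℕ) : Prop :=
  ∀ i < L, Avail l fun x => (Y x).testBit i

lemma AvailNat.mono {ι : Type} {l l' : List ((ι → Bool) → Bool)} {L : ℕ}
    {Y : (ι → Bool) → ℕ} (h : AvailNat l L Y) (hl : l <+: l') : AvailNat l' L Y :=
  fun i hi => (h i hi).mono hl

lemma AvailNat.extend {ι : Type} {l : List ((ι → Bool) → Bool)} {L : ℕ}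
    {Y : (ι → Bool) → ℕ} (h : AvailNat l L Y) (h0 : Avail l fun _ => false)
    (hY : ∀ x, Y x < 2 ^ L) (L' : ℕ) : AvailNat l L' Y := by
  intro i _
  by_cases hi : i < L
  · exact h i hi
  · have : (fun x => (Y x).testBit i) = fun _ => false := by
      funext x
      exact Nat.testBit_lt_two_pow ((hY x).trans_le (Nat.pow_le_pow_right two_pos (by omega)))
    rwa [this]

lemma availNat_const {ι : Type} {l : List ((ι → Bool) → Bool)} (h0 : Avail l fun _ => false)
    (h1 : Avail l fun _ => true) (L a : ℕ) : AvailNat l L fun _ => a := by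
  intro i _
  cases h : a.testBit i <;> simpa [h]

/-- Ripple-carry addition: per position, two steps for the sum bit and four for the carry. -/
lemma Straight.exists_add {ι : Type} {l : List ((ι → Bool) → Bool)} (hl : Straight l)
    (h0 : Avail l fun _ => false) (L : ℕ) (Y Z : (ι → Bool) → ℕ)
    (hY : AvailNat l L Y) (hZ : AvailNat l L Z) :
    ∃ l₂, Extends l l₂ (6 * L) ∧ (Avail l₂ fun x => addCarry L (Y x) (Z x)) ∧
      AvailNat l₂ L fun x => Y x + Z x := by
  induction L with
  | zero =>
    refine ⟨l, Extends.refl hl, ?_, fun i hi => absurd hi (Nat.not_lt_zero i)⟩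
    simpa [addCarry, Nat.mod_one] using h0
  | succ L ih =>
    obtain ⟨l₂, he, hc, hs⟩ := ih (fun i hi => hY i (by omega)) fun i hi => hZ i (by omega)
    have hy := (hY L (Nat.lt_succ_self L)).mono he.1
    have hz := (hZ L (Nat.lt_succ_self L)).mono he.1
    obtain ⟨l₃, e₃, h₃⟩ := he.2.1.exists_xor hz hc
    obtain ⟨l₄, e₄, h₄⟩ := e₃.2.1.exists_xor (hy.mono e₃.1) h₃
    have e24 := e₃.trans e₄
    obtain ⟨l₅, e₅, h₅⟩ := e₄.2.1.exists_and (hy.mono e24.1) (hz.mono e24.1)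
    have e25 := e24.trans e₅
    obtain ⟨l₆, e₆, h₆⟩ := e₅.2.1.exists_xor (hy.mono e25.1) (hz.mono e25.1)
    have e26 := e25.trans e₆
    obtain ⟨l₇, e₇, h₇⟩ := e₆.2.1.exists_and (hc.mono e26.1) h₆
    obtain ⟨l₈, e₈, h₈⟩ := e₇.2.1.exists_xor (h₅.mono (e₆.trans e₇).1) h₇
    have e28 := (e26.trans e₇).trans e₈
    refine ⟨l₈, (he.trans e28).mono (by omega), ?_, fun i hi => ?_⟩
    · simpa only [addCarry_succ] using h₈
    · rcases Nat.lt_succ_iff_lt_or_eq.1 hi with h | rfl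
      · exact (hs i h).mono e28.1
      · simp only [testBit_add_eq]
        exact h₄.mono (((e₅.trans e₆).trans e₇).trans e₈).1

/-- Bitwise y ⊕ (o ∧ (y ⊕ z)), three steps per position. -/
lemma Straight.exists_mux {ι : Type} {l : List ((ι → Bool) → Bool)} (hl : Straight l)
    {o : (ι → Bool) → Bool} (ho : Avail l o) (L : ℕ) (Y Z : (ι → Bool) → ℕ)
    (hY : AvailNat l L Y) (hZ : AvailNat l L Z) :
    ∃ l₂, Extends l l₂ (3 * L) ∧ AvailNat l₂ L fun x => if o x then Z x else Y x := by
  induction L with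
  | zero => exact ⟨l, Extends.refl hl, fun i hi => absurd hi (Nat.not_lt_zero i)⟩
  | succ L ih =>
    obtain ⟨l₂, he, hs⟩ := ih (fun i hi => hY i (by omega)) fun i hi => hZ i (by omega)
    have hy := (hY L (Nat.lt_succ_self L)).mono he.1
    have hz := (hZ L (Nat.lt_succ_self L)).mono he.1
    obtain ⟨l₃, e₃, h₃⟩ := he.2.1.exists_xor hy hz
    obtain ⟨l₄, e₄, h₄⟩ := e₃.2.1.exists_and ((ho.mono he.1).mono e₃.1) h₃
    have e24 := e₃.trans e₄
    obtain ⟨l₅, e₅, h₅⟩ := e₄.2.1.exists_xor (hy.mono e24.1) h₄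
    refine ⟨l₅, (he.trans (e24.trans e₅)).mono (by omega), fun i hi => ?_⟩
    rcases Nat.lt_succ_iff_lt_or_eq.1 hi with h | rfl
    · exact (hs i h).mono (e24.trans e₅).1
    · convert h₅ using 2 with x
      cases ho : o x <;> cases hy : (Y x).testBit i <;> simp [ho, hy]

/-- Adding 2^(L+1) - q to the integer sum sets bit L + 1 exactly when the sum is at least q, and
then the low bits hold the reduced value; that bit drives a multiplexer. Two additions on L + 2 bits
and a selection on L bits take 15L + 24 steps. -/
lemma Straight.exists_condAdd {ι : Type} {l : List ((ι → Bool) → Bool)} (hl : Straight l)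
    (h0 : Avail l fun _ => false) (h1 : Avail l fun _ => true) {q L : ℕ} [NeZero q]
    (hq : q ≤ 2 ^ L) (z : (ι → Bool) → ZMod q) (hz : AvailNat l L fun x => (z x).val)
    {b : (ι → Bool) → Bool} (hb : Avail l b) (a : ZMod q) :
    ∃ l₂, Extends l l₂ (15 * L + 24) ∧
      AvailNat l₂ L fun x => (z x + if b x then a else 0).val := by
  have hy := hz.extend h0 (fun x => (ZMod.val_lt _).trans_le hq) (L + 2)
  have ha : AvailNat l (L + 2) fun x => if b x then a.val else 0 := by
    intro i _
    cases h : a.val.testBit i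
    · convert h0 using 2 with x
      cases hx : b x <;> simp [hx, h]
    · convert hb using 2 with x
      cases hx : b x <;> simp [hx, h]
  obtain ⟨l₂, e₂, -, h₂⟩ := hl.exists_add h0 (L + 2) _ _ hy ha
  obtain ⟨l₃, e₃, -, h₃⟩ := e₂.2.1.exists_add (h0.mono e₂.1) (L + 2) _ _ h₂
    (availNat_const (h0.mono e₂.1) (h1.mono e₂.1) (L + 2) (2 ^ (L + 1) - q))
  obtain ⟨l₄, e₄, h₄⟩ := e₃.2.1.exists_mux (h₃ (L + 1) (by omega)) L _ _
    (fun i hi => (h₂ i (by omega)).mono e₃.1) fun i hi => h₃ i (by omega)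
  refine ⟨l₄, ((e₂.trans e₃).trans e₄).mono (by omega), fun i hi => ?_⟩
  convert h₄ i hi using 2 with x
  have hv : (if b x then a.val else 0) = (if b x then a else 0).val := by
    split <;> simp
  beta_reduce
  rw [hv]
  generalize (if b x then a else 0) = a'
  have hzq := ZMod.val_lt (z x)
  have haq := ZMod.val_lt a'
  have hp : 2 ^ (L + 1) = 2 * 2 ^ L := pow_succ' 2 L
  by_cases hlt : (z x).val + a'.val < q
  · rw [if_neg, ZMod.val_add_of_lt hlt]
    rw [Nat.testBit_lt_two_pow (by omega)]
    simp
  · have h := ZMod.val_add_val_of_le (not_lt.1 hlt)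
    have hS : (z x).val + a'.val + (2 ^ (L + 1) - q) = 2 ^ (L + 1) + (z x + a').val := by omega
    have hr := ZMod.val_lt (z x + a')
    rw [hS, if_pos, Nat.testBit_two_pow_add_gt (by omega)]
    rw [Nat.testBit_two_pow_add_eq, Nat.testBit_lt_two_pow (by omega)]
    rfl

lemma Straight.exists_condSum {ι : Type} {l : List ((ι → Bool) → Bool)} (hl : Straight l)
    (h0 : Avail l fun _ => false) (h1 : Avail l fun _ => true) {q L : ℕ} [NeZero q]
    (hq : q ≤ 2 ^ L) (c : ZMod q) {T : Type} (s : Finset T) (b : T → (ι → Bool) → Bool)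
    (hb : ∀ t, Avail l (b t)) (a : T → ZMod q) :
    ∃ l₂, Extends l l₂ (s.card * (15 * L + 24)) ∧
      AvailNat l₂ L fun x => (c + ∑ t ∈ s, if b t x then a t else 0).val := by
  classical
  induction s using Finset.induction_on with
  | empty =>
    refine ⟨l, (Extends.refl hl).mono (by simp), ?_⟩
    simpa using availNat_const h0 h1 L c.val
  | insert t s ht ih =>
    obtain ⟨l₂, e₂, h₂⟩ := ih
    obtain ⟨l₃, e₃, h₃⟩ := e₂.2.1.exists_condAdd (h0.mono e₂.1) (h1.mono e₂.1) hq _ h₂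
      ((hb t).mono e₂.1) (a t)
    refine ⟨l₃, (e₂.trans e₃).mono (by rw [Finset.card_insert_of_notMem ht]; ring_nf; rfl), ?_⟩
    convert h₃ using 3 with x
    rw [Finset.sum_insert ht]
    ring

lemma exists_family {ι O : Type} (P : O → List ((ι → Bool) → Bool) → Prop)
    (hP : ∀ o l l', l <+: l' → P o l → P o l') (N : ℕ) {l : List ((ι → Bool) → Bool)}
    (hl : Straight l)
    (h : ∀ o l', l <+: l' → Straight l' → ∃ l₂, Extends l' l₂ N ∧ P o l₂) (s : Finset O) :
    ∃ l₂, Extends l l₂ (s.card * N) ∧ ∀ o ∈ s, P o l₂ := by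
  classical
  induction s using Finset.induction_on with
  | empty => exact ⟨l, (Extends.refl hl).mono (by simp), by simp⟩
  | insert t s ht ih =>
    obtain ⟨l₂, e₂, h₂⟩ := ih
    obtain ⟨l₃, e₃, h₃⟩ := h t l₂ e₂.1 e₂.2.1
    refine ⟨l₃, (e₂.trans e₃).mono (by rw [Finset.card_insert_of_notMem ht]; ring_nf; rfl), ?_⟩
    intro o ho
    rcases Finset.mem_insert.1 ho with rfl | ho
    · exact h₃
    · exact hP _ _ _ e₃.1 (h₂ o ho)

/-- The binary encoding of a vector over `ℤ_q`. -/
def encodeVec {q : ℕ} {I : Type} (v : I → ZMod q) : I × Fin (Nat.clog 2 q) → Bool :=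
  fun w => (v w.1).val.testBit w.2

/-- The affine map with matrix `M` and constant term `c`. -/
def affineFun {q : ℕ} {I O : Type} [Fintype I] (M : O → I → ZMod q) (c : O → ZMod q)
    (v : I → ZMod q) : O → ZMod q :=
  fun o => c o + ∑ i, M o i * v i

lemma sum_testBit (L y : ℕ) (hy : y < 2 ^ L) :
    ∑ k ∈ Finset.range L, (if y.testBit k then 2 ^ k else 0) = y := by
  have key : ∀ L, ∑ k ∈ Finset.range L, (if y.testBit k then 2 ^ k else 0) = y % 2 ^ L := by
    intro L
    induction L with
    | zero => simp [Nat.mod_one]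
    | succ L ih =>
      rw [Finset.sum_range_succ, ih, Nat.mod_pow_succ, ← Nat.toNat_testBit]
      cases y.testBit L <;> simp
  rw [key, Nat.mod_eq_of_lt hy]

lemma sum_encodeVec {q : ℕ} [NeZero q] {I : Type} (v : I → ZMod q) (i : I) (a : ZMod q) :
    ∑ k, (if encodeVec v (i, k) then a * 2 ^ (k : ℕ) else 0) = a * v i := by
  have h := sum_testBit (Nat.clog 2 q) (v i).val
    ((ZMod.val_lt _).trans_le (Nat.le_pow_clog one_lt_two q))
  have h2 := congrArg (fun t : ℕ => a * (t : ZMod q)) h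
  simp only [ZMod.natCast_val, ZMod.cast_id', id_eq] at h2
  rw [← h2, Nat.cast_sum, Finset.mul_sum,
    ← Fin.sum_univ_eq_sum_range (fun k => a * ((if (v i).val.testBit k then 2 ^ k else 0 : ℕ) :
      ZMod q))]
  refine Finset.sum_congr rfl fun k _ => ?_
  simp only [encodeVec]
  by_cases hk : (v i).val.testBit k = true <;> simp [hk]

/-- Precomposing a quantum circuit with an affine map over `ℤ_q`. -/
theorem QCircuit.exists_precompose_affine {q : ℕ} [NeZero q] {I O : Type} [Fintype I]
    [DecidableEq I] [Fintype O] [DecidableEq O] (C : QCircuit (O × Fin (Nat.clog 2 q)))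
    (M : O → I → ZMod q) (c : O → ZMod q) :
    ∃ C' : QCircuit (I × Fin (Nat.clog 2 q)),
      C'.size ≤ C.size + 3 * (2 + Fintype.card O * (Fintype.card I * Nat.clog 2 q *
        (15 * Nat.clog 2 q + 24)) + Fintype.card O * Nat.clog 2 q) ∧
      ∀ v S, C'.probMem (encodeVec v) S = C.probMem (encodeVec (affineFun M c v)) S := by
  -- By binary expansion of the inputs, the affine map is a sum of constants switched on by input
  -- bits, so conditional additions suffice.
  let val : O → (I × Fin (Nat.clog 2 q) → Bool) → ZMod q := fun o x =>
    c o + ∑ t : I × Fin (Nat.clog 2 q), if x t then M o t.1 * 2 ^ (t.2 : ℕ) else 0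
  obtain ⟨l, hl, hlen, h0, h1⟩ := exists_consts (I × Fin (Nat.clog 2 q))
  obtain ⟨l₂, e₂, h₂⟩ := exists_family
    (fun (o : O) l => AvailNat l (Nat.clog 2 q) fun x => (val o x).val)
    (fun o l l' h hP => hP.mono h) (Fintype.card I * Nat.clog 2 q * 
      (15 * Nat.clog 2 q + 24)) hl
    (fun o l' hpre hl' => by
      have := hl'.exists_condSum (h0.mono hpre) (h1.mono hpre) (Nat.le_pow_clog one_lt_two q)
        (c o) Finset.univ (fun (t : I × Fin (Nat.clog 2 q)) x => x t) (fun t => Or.inr ⟨t, rfl⟩)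
        fun t => M o t.1 * 2 ^ (t.2 : ℕ)
      simpa [Finset.card_univ] using this) Finset.univ
  obtain ⟨C', hs, hC'⟩ := C.exists_precompose e₂.2.1
    (fun x w => (val w.1 x).val.testBit w.2) fun w => h₂ w.1 (Finset.mem_univ _) w.2 w.2.2
  refine ⟨C', ?_, fun v S => ?_⟩
  · have := e₂.2.2
    rw [Finset.card_univ] at this
    rw [Fintype.card_prod, Fintype.card_fin] at hs
    omega
  · rw [hC']
    congr 1
    funext w
    simp only [encodeVec, val, affineFun, Fintype.sum_prod_type]
    congr 3
    exact Finset.sum_congr rfl fun i _ => sum_encodeVec v i _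

/-! ### Expectations over finite probability spaces -/

/-- The expectation of `f` with respect to the density `p`. -/
def Ex {X : Type} [Fintype X] (p f : X → ℝ) : ℝ := ∑ x, p x * f x

section Expectation

variable {X Y : Type} [Fintype X] [Fintype Y]

lemma Ex_congr {p f g : X → ℝ} (h : ∀ x, f x = g x) : Ex p f = Ex p g :=
  congrArg _ (funext h)

lemma Ex_sub (p f g : X → ℝ) : Ex p (fun x => f x - g x) = Ex p f - Ex p g := by
  simp [Ex, mul_sub]

lemma Ex_const_mul (p f : X → ℝ) (a : ℝ) : Ex p (fun x => a * f x) = a * Ex p f := by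
  simp only [Ex, Finset.mul_sum]
  exact Finset.sum_congr rfl fun x _ => by ring

lemma Ex_mul_const (p f : X → ℝ) (a : ℝ) : Ex p (fun x => f x * a) = Ex p f * a := by
  simp only [Ex, Finset.sum_mul]
  exact Finset.sum_congr rfl fun x _ => by ring

lemma Ex_const {p : X → ℝ} (hp : IsDensity p) (a : ℝ) : Ex p (fun _ => a) = a := by
  rw [Ex, ← Finset.sum_mul, hp.2, one_mul]

lemma Ex_mono {p f g : X → ℝ} (hp : IsDensity p) (h : ∀ x, f x ≤ g x) : Ex p f ≤ Ex p g :=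
  Finset.sum_le_sum fun x _ => mul_le_mul_of_nonneg_left (h x) (hp.1 x)

lemma abs_Ex_le_of_support {p f : X → ℝ} (hp : IsDensity p) {ε : ℝ}
    (h : ∀ x, p x ≠ 0 → |f x| ≤ ε) : |Ex p f| ≤ ε := by
  calc |Ex p f| ≤ ∑ x, |p x * f x| := Finset.abs_sum_le_sum_abs _ _
    _ ≤ ∑ x, p x * ε := by
        refine Finset.sum_le_sum fun x _ => ?_
        rw [abs_mul, abs_of_nonneg (hp.1 x)]
        by_cases hx : p x = 0
        · simp [hx]
        · exact mul_le_mul_of_nonneg_left (h x hx) (hp.1 x)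
    _ = ε := by rw [← Finset.sum_mul, hp.2, one_mul]

lemma abs_Ex_le {p f : X → ℝ} (hp : IsDensity p) {ε : ℝ} (h : ∀ x, |f x| ≤ ε) :
    |Ex p f| ≤ ε :=
  abs_Ex_le_of_support hp fun x _ => h x

lemma abs_Ex_sub_le {p f g : X → ℝ} (hp : IsDensity p) {ε : ℝ} (h : ∀ x, |f x - g x| ≤ ε) :
    |Ex p f - Ex p g| ≤ ε := by
  rw [← Ex_sub]
  exact abs_Ex_le hp h

lemma abs_Ex_le_Ex_abs {p : X → ℝ} (hp : IsDensity p) (f : X → ℝ) :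
    |Ex p f| ≤ Ex p fun x => |f x| := by
  refine (Finset.abs_sum_le_sum_abs _ _).trans (le_of_eq (Finset.sum_congr rfl fun x _ => ?_))
  rw [abs_mul, abs_of_nonneg (hp.1 x)]

lemma Ex_comm (p : X → ℝ) (r : Y → ℝ) (f : X → Y → ℝ) :
    Ex p (fun x => Ex r fun y => f x y) = Ex r fun y => Ex p fun x => f x y := by
  simp only [Ex, Finset.mul_sum]
  rw [Finset.sum_comm]
  exact Finset.sum_congr rfl fun y _ => Finset.sum_congr rfl fun x _ => by ring

lemma abs_Ex_sub_Ex_le (p r f : X → ℝ) {M : ℝ} (h : ∀ x, |f x| ≤ M) :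
    |Ex p f - Ex r f| ≤ M * ∑ x, |p x - r x| := by
  rw [Ex, Ex, ← Finset.sum_sub_distrib, Finset.mul_sum]
  refine (Finset.abs_sum_le_sum_abs _ _).trans (Finset.sum_le_sum fun x _ => ?_)
  rw [← sub_mul, abs_mul, mul_comm]
  exact mul_le_mul_of_nonneg_right (h x) (abs_nonneg _)

lemma isDensity_unif [Nonempty X] : IsDensity (unif X) := by
  refine ⟨fun x => by unfold unif; positivity, ?_⟩
  simp [unif]

lemma Ex_unif_equiv (e : X ≃ Y) (f : Y → ℝ) :
    Ex (unif Y) f = Ex (unif X) fun x => f (e x) := by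
  unfold Ex unif
  rw [Fintype.card_congr e]
  exact (Equiv.sum_comp e _).symm

lemma Ex_unif_prod (f : X × Y → ℝ) :
    Ex (unif (X × Y)) f = Ex (unif X) fun x => Ex (unif Y) fun y => f (x, y) := by
  simp only [Ex, unif, Fintype.sum_prod_type, Finset.mul_sum, Fintype.card_prod, Nat.cast_mul]
  exact Finset.sum_congr rfl fun x _ => Finset.sum_congr rfl fun y _ => by ring

lemma iidDensity_unif (m : ℕ) : iidDensity m (unif X) = unif (Fin m → X) := by
  funext e
  simp [iidDensity, unif]

lemma isDensity_iid (m : ℕ) {χ : X → ℝ} (hχ : IsDensity χ) : IsDensity (iidDensity m χ) := by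
  classical
  refine ⟨fun e => Finset.prod_nonneg fun i _ => hχ.1 _, ?_⟩
  have := Finset.prod_univ_sum (fun _ : Fin m => (Finset.univ : Finset X)) fun _ x => χ x
  simp only [hχ.2, Finset.prod_const_one, Fintype.piFinset_univ] at this
  exact this.symm

/-- Resampling one coordinate does not change the expectation. -/
lemma Ex_iid_resample {m : ℕ} {χ : X → ℝ} (hχ : IsDensity χ) (j : Fin m)
    (f : (Fin m → X) → ℝ) :
    Ex (iidDensity m χ) f =
      Ex (iidDensity m χ) fun D => Ex χ fun x => f (Function.update D j x) := by
  -- Exchanging the old coordinate with the fresh sample is an involution that preserves the joint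
  -- density.
  have hσ : Function.Involutive fun z : (Fin m → X) × X =>
      (Function.update z.1 j z.2, z.1 j) := by
    rintro ⟨D, x⟩
    simp
  have hw : ∀ z : (Fin m → X) × X,
      iidDensity m χ (Function.update z.1 j z.2) * χ (z.1 j) = iidDensity m χ z.1 * χ z.2 := by
    rintro ⟨D, x⟩
    simp only [iidDensity, Function.update_apply, apply_ite χ]
    rw [← Finset.mul_prod_erase _ _ (Finset.mem_univ j),
      ← Finset.mul_prod_erase Finset.univ (fun i => χ (D i)) (Finset.mem_univ j),
      Finset.prod_congr rfl fun i hi => if_neg (Finset.ne_of_mem_erase hi)]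
    simp only [if_true]
    ring
  have h := Equiv.sum_comp (Function.Involutive.toPerm _ hσ)
    fun z : (Fin m → X) × X => iidDensity m χ z.1 * χ z.2 * f z.1
  simp only [Function.Involutive.coe_toPerm, hw, Fintype.sum_prod_type] at h
  simp only [Ex, Finset.mul_sum]
  calc ∑ D, iidDensity m χ D * f D = ∑ D, ∑ x, iidDensity m χ D * χ x * f D := by
        refine Finset.sum_congr rfl fun D _ => ?_
        rw [← Finset.sum_mul, ← Finset.mul_sum, hχ.2, mul_one]
    _ = _ := by
        rw [← h]
        exact Finset.sum_congr rfl fun D _ => Finset.sum_congr rfl fun x _ => by ring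

lemma Ex_unif_resample {m : ℕ} [Nonempty X] (j : Fin m) (f : (Fin m → X) → ℝ) :
    Ex (unif (Fin m → X)) f =
      Ex (unif (Fin m → X)) fun D => Ex (unif X) fun x => f (Function.update D j x) := by
  rw [← iidDensity_unif]
  exact Ex_iid_resample isDensity_unif j f

/-- Telescoping over coordinates by f₀f' - g₀g' = (f₀ - g₀)f' + g₀(f' - g'), where the unchanged
factor sums to one. -/
lemma sum_abs_prod_sub_prod_le {m : ℕ} (f g : Fin m → X → ℝ) (hf : ∀ i, IsDensity (f i))
    (hg : ∀ i, IsDensity (g i)) :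
    ∑ e : Fin m → X, |∏ i, f i (e i) - ∏ i, g i (e i)| ≤ ∑ i, ∑ x, |f i x - g i x| := by
  classical
  induction m with
  | zero => simp
  | succ m ih =>
    have h1 : ∑ e : Fin m → X, ∏ i, f i.succ (e i) = 1 := by
      have := Finset.prod_univ_sum (fun _ : Fin m => (Finset.univ : Finset X))
        fun i x => f i.succ x
      simp only [(hf _).2, Finset.prod_const_one, Fintype.piFinset_univ] at this
      exact this.symm
    rw [← Equiv.sum_comp (Fin.consEquiv fun _ : Fin (m + 1) => X), Fintype.sum_prod_type,
      Fin.sum_univ_succ]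
    calc _ ≤ ∑ x : X, ∑ e : Fin m → X, (|f 0 x - g 0 x| * ∏ i, f i.succ (e i) +
          g 0 x * |∏ i, f i.succ (e i) - ∏ i, g i.succ (e i)|) := by
          refine Finset.sum_le_sum fun x _ => Finset.sum_le_sum fun e _ => ?_
          simp only [Fin.consEquiv, Equiv.coe_fn_mk, Fin.prod_univ_succ, Fin.cons_zero,
            Fin.cons_succ]
          have hp : 0 ≤ ∏ i, f i.succ (e i) := Finset.prod_nonneg fun i _ => (hf _).1 _
          rw [show f 0 x * ∏ i, f i.succ (e i) - g 0 x * ∏ i, g i.succ (e i) =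
            (f 0 x - g 0 x) * ∏ i, f i.succ (e i) +
              g 0 x * (∏ i, f i.succ (e i) - ∏ i, g i.succ (e i)) by ring]
          refine (abs_add_le _ _).trans (le_of_eq ?_)
          rw [abs_mul, abs_mul, abs_of_nonneg hp, abs_of_nonneg ((hg 0).1 x)]
      _ = ∑ x, |f 0 x - g 0 x| +
          ∑ e : Fin m → X, |∏ i, f i.succ (e i) - ∏ i, g i.succ (e i)| := by
          simp only [Finset.sum_add_distrib, ← Finset.mul_sum, ← Finset.sum_mul, h1, (hg 0).2,
            mul_one, one_mul]
      _ ≤ _ := by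
          have := ih (fun i => f i.succ) (fun i => g i.succ) (fun i => hf _) fun i => hg _
          linarith

/-- The density of the image of a random element. -/
def pushDensity [DecidableEq Y] (r : X → ℝ) (φ : X → Y) (y : Y) : ℝ :=
  Ex r fun x => if φ x = y then 1 else 0

lemma isDensity_pushDensity [DecidableEq Y] {r : X → ℝ} (hr : IsDensity r) (φ : X → Y) :
    IsDensity (pushDensity r φ) := by
  refine ⟨fun y => Finset.sum_nonneg fun x _ => mul_nonneg (hr.1 x) (by dsimp only; split <;> norm_num), ?_⟩
  unfold pushDensity Ex
  rw [Finset.sum_comm]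
  simp [hr.2]

lemma Ex_iid_comp [DecidableEq Y] (m : ℕ) (r : X → ℝ) (φ : X → Y) (Θ : (Fin m → Y) → ℝ) :
    Ex (iidDensity m r) (fun R => Θ fun i => φ (R i)) =
      Ex (iidDensity m (pushDensity r φ)) Θ := by
  classical
  have h : ∀ y : Fin m → Y, iidDensity m (pushDensity r φ) y =
      ∑ R : Fin m → X, iidDensity m r R * if (fun i => φ (R i)) = y then 1 else 0 := by
    intro y
    unfold iidDensity pushDensity Ex
    rw [Finset.prod_univ_sum, Fintype.piFinset_univ]
    refine Finset.sum_congr rfl fun R _ => ?_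
    rw [Finset.prod_mul_distrib]
    congr 1
    rw [Finset.prod_ite_zero]
    simp [funext_iff]
  simp only [Ex, h, Finset.sum_mul]
  rw [Finset.sum_comm]
  refine Finset.sum_congr rfl fun R _ => ?_
  simp

/-- Translating independent samples moves an expectation by at most the sum of the distances. -/
lemma abs_Ex_iid_add_sub_le [AddGroup X] {m : ℕ} {χ : X → ℝ} (hχ : IsDensity χ)
    (δ : Fin m → X) (f : (Fin m → X) → ℝ) {M : ℝ} (hM : 0 ≤ M) (hf : ∀ e, |f e| ≤ M) :
    |Ex (iidDensity m χ) (fun e => f (e + δ)) - Ex (iidDensity m χ) f| ≤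
      M * ∑ i, ∑ x, |χ (x - δ i) - χ x| := by
  have h : Ex (iidDensity m χ) (fun e => f (e + δ)) =
      Ex (fun e => ∏ i, χ (e i - δ i)) f := by
    unfold Ex
    rw [← Equiv.sum_comp (Equiv.addRight δ) fun e => (∏ i, χ (e i - δ i)) * f e]
    simp [iidDensity]
  rw [h]
  refine (abs_Ex_sub_Ex_le _ _ _ hf).trans (mul_le_mul_of_nonneg_left ?_ hM)
  refine sum_abs_prod_sub_prod_le (fun i x => χ (x - δ i)) (fun _ => χ) (fun i => ?_) fun _ => hχ
  refine ⟨fun x => hχ.1 _, ?_⟩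
  rw [← hχ.2]
  exact Equiv.sum_comp (Equiv.subRight (δ i)) χ

lemma Ex_unif_ite_eq [DecidableEq X] (y : X) : Ex (unif X) (fun x => if x = y then 1 else 0) =
    1 / Fintype.card X := by
  simp [Ex, unif]

end Expectation

/-! ### Random subset sums -/

/-- The sum of the elements selected by `s`. -/
def subsetSum {n : ℕ} {V : Type} [AddCommGroup V] (C : Fin n → V) (s : Fin n → Bool) : V :=
  ∑ i, if s i then C i else 0

section SubsetSum

variable {n : ℕ} {V : Type} [AddCommGroup V]

lemma subsetSum_update (C : Fin n → V) (s : Fin n → Bool) (j : Fin n) (x : V) :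
    subsetSum (Function.update C j x) s =
      (if s j then x else 0) + ∑ i ∈ Finset.univ.erase j, if s i then C i else 0 := by
  unfold subsetSum
  rw [← Finset.add_sum_erase _ _ (Finset.mem_univ j), Function.update_self]
  congr 1
  exact Finset.sum_congr rfl fun i hi => by rw [Function.update_of_ne (Finset.ne_of_mem_erase hi)]

variable [Fintype V] [DecidableEq V]

/-- At a position where `s` and `t` differ, the element enters exactly one of the two sums. Given
all others, exactly one value of it makes the sums equal. -/
lemma Ex_subsetSum_eq {s t : Fin n → Bool} (h : s ≠ t) :
    Ex (unif (Fin n → V)) (fun C => if subsetSum C s = subsetSum C t then 1 else 0) =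
      1 / Fintype.card V := by
  obtain ⟨j, hj⟩ := Function.ne_iff.1 h
  rw [Ex_unif_resample j]
  rw [← Ex_const (p := unif (Fin n → V)) isDensity_unif (1 / (Fintype.card V : ℝ))]
  congr 1
  funext D
  simp only [subsetSum_update]
  generalize ∑ i ∈ Finset.univ.erase j, (if s i then D i else 0) = a
  generalize ∑ i ∈ Finset.univ.erase j, (if t i then D i else 0) = b
  rcases hs : s j with _ | _ <;> rcases ht : t j with _ | _
  · exact absurd (hs.trans ht.symm) hj
  · rw [← Ex_unif_ite_eq (a - b)]
    congr 1
    funext x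
    simp [eq_sub_iff_add_eq, eq_comm]
  · rw [← Ex_unif_ite_eq (b - a)]
    congr 1
    funext x
    simp [eq_sub_iff_add_eq]
  · exact absurd (hs.trans ht.symm) hj

/-- Centred indicators turn a squared distance to uniform into a collision probability minus 1/|V|.
-/
lemma sum_centered_mul (y z : V) :
    ∑ v : V, ((if y = v then 1 else 0) - 1 / (Fintype.card V : ℝ)) *
      ((if z = v then 1 else 0) - 1 / (Fintype.card V : ℝ)) =
      (if y = z then 1 else 0) - 1 / Fintype.card V := by
  have hN : (Fintype.card V : ℝ) ≠ 0 := by simp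
  simp only [sub_mul, mul_sub, Finset.sum_sub_distrib, ← Finset.sum_mul, ← Finset.mul_sum]
  simp

/-- The distribution of a random subset sum, weighted by a bounded function of the subset, is close
to uniform for most families. -/
theorem Ex_sum_abs_subsetSum_le (χ : (Fin n → Bool) → ℝ) (hχ : ∀ s, |χ s| ≤ 1) :
    Ex (unif (Fin n → V)) (fun C => ∑ y, |Ex (unif _) fun s =>
      χ s * ((if subsetSum C s = y then 1 else 0) - 1 / (Fintype.card V : ℝ))|) ≤
      Real.sqrt (Fintype.card V / 2 ^ n) := by
  set N : ℝ := ((Fintype.card V : ℕ) : ℝ) with hN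
  have hNpos : 0 < N := by rw [hN]; exact_mod_cast Fintype.card_pos
  set K : ℝ := ((Fintype.card (Fin n → V) : ℕ) : ℝ) with hK
  have hKpos : 0 < K := by rw [hK]; exact_mod_cast Fintype.card_pos
  let a : (Fin n → V) → V → ℝ := fun C y => Ex (unif _) fun s =>
      χ s * ((if subsetSum C s = y then 1 else 0) - 1 / N)
  -- Second moment, expanded over pairs (s, t): off the diagonal the collision probability is
  -- exactly 1/N and the term vanishes; the diagonal has weight 2^(-n).
  have h2 : Ex (unif (Fin n → V)) (fun C => ∑ y, a C y ^ 2) ≤ 1 / 2 ^ n := by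
    have e1 : ∀ C, ∑ y, a C y ^ 2 = Ex (unif (Fin n → Bool)) fun s =>
        Ex (unif (Fin n → Bool)) fun t =>
          χ s * χ t * ((if subsetSum C s = subsetSum C t then 1 else 0) - 1 / N) := by
      intro C
      simp only [a, sq, Ex, Finset.sum_mul_sum]
      rw [Finset.sum_comm]
      refine Finset.sum_congr rfl fun s _ => ?_
      rw [Finset.sum_comm, Finset.mul_sum]
      refine Finset.sum_congr rfl fun t _ => ?_
      rw [← sum_centered_mul, Finset.mul_sum, Finset.mul_sum, Finset.mul_sum]
      exact Finset.sum_congr rfl fun y _ => by ring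
    simp only [e1]
    rw [Ex_comm]
    have e2 : ∀ s, |Ex (unif (Fin n → V)) (fun C => Ex (unif (Fin n → Bool)) fun t =>
        χ s * χ t * ((if subsetSum C s = subsetSum C t then 1 else 0) - 1 / N))| ≤ 1 / 2 ^ n := by
      intro s
      rw [Ex_comm]
      simp only [Ex_const_mul, Ex_sub, Ex_const (isDensity_unif (X := Fin n → V))]
      rw [Ex, Finset.sum_eq_single s]
      · simp only [if_true]
        rw [Ex_const isDensity_unif]
        have hN1 : 1 ≤ N := by rw [hN]; exact_mod_cast Fintype.card_pos
        have h1N : 1 / N ≤ 1 := by rw [div_le_one hNpos]; exact hN1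
        have h0N : 0 < 1 / N := by positivity
        have hu : unif (Fin n → Bool) s = 1 / 2 ^ n := by simp [unif]
        rw [hu, abs_mul, abs_mul, abs_mul, abs_of_nonneg (by positivity : (0 : ℝ) ≤ 1 / 2 ^ n),
          abs_of_nonneg (by linarith : 0 ≤ 1 - 1 / N)]
        refine mul_le_of_le_one_right (by positivity) ?_
        have := mul_le_one₀ (hχ s) (abs_nonneg _) (hχ s)
        exact mul_le_one₀ this (by linarith) (by linarith)
      · intro t _ ht
        rw [Ex_subsetSum_eq ht.symm, sub_self]
        simp
      · simp
    exact (le_abs_self _).trans (abs_Ex_le isDensity_unif e2)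
  refine Real.le_sqrt_of_sq_le ?_
  -- Cauchy–Schwarz over all K·N pairs (C, y).
  have hcs := sq_sum_le_card_mul_sum_sq (s := (Finset.univ : Finset ((Fin n → V) × V)))
    (f := fun z => |a z.1 z.2|)
  simp only [sq_abs, Fintype.sum_prod_type, Finset.card_univ, Fintype.card_prod,
    Nat.cast_mul] at hcs
  rw [← hN, ← hK] at hcs
  have e3 : ∀ g : (Fin n → V) → ℝ, Ex (unif (Fin n → V)) g = (∑ C, g C) / K := by
    intro g
    simp only [Ex, unif, ← Finset.mul_sum]
    rw [← hK]
    ring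
  rw [e3] at h2 ⊢
  rw [div_le_iff₀ hKpos] at h2
  rw [div_pow, div_le_iff₀ (by positivity)]
  calc _ ≤ K * N * ∑ C, ∑ y, a C y ^ 2 := hcs
    _ ≤ K * N * (1 / 2 ^ n * K) := by gcongr
    _ = _ := by ring

/-- Leftover hash lemma for a matrix of independent random subset sums. -/
theorem abs_Ex_subsetSum_sub_le {m : ℕ} (Θ : (Fin m → V) → ℝ) {M : ℝ} (hM : 0 ≤ M)
    (hΘ : ∀ y, |Θ y| ≤ M) :
    |Ex (unif (Fin n → V)) (fun C => Ex (unif (Fin m → Fin n → Bool)) fun R =>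
        Θ fun i => subsetSum C (R i)) - Ex (unif (Fin m → V)) Θ| ≤
      M * (m * Real.sqrt (Fintype.card V / 2 ^ n)) := by
  have hC : ∀ C : Fin n → V, |Ex (unif (Fin m → Fin n → Bool)) (fun R =>
      Θ fun i => subsetSum C (R i)) - Ex (unif (Fin m → V)) Θ| ≤
      M * (m * ∑ y, |Ex (unif _) fun s =>
        1 * ((if subsetSum C s = y then 1 else 0) - 1 / (Fintype.card V : ℝ))|) := by
    intro C
    -- For fixed `C` the `m` sums are independent and identically distributed, so the distance to
    -- uniform is at most `m` times that of one sum.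
    rw [← iidDensity_unif (X := Fin n → Bool), Ex_iid_comp, ← iidDensity_unif (X := V)]
    refine (abs_Ex_sub_Ex_le _ _ _ hΘ).trans (mul_le_mul_of_nonneg_left ?_ hM)
    refine (sum_abs_prod_sub_prod_le _ _
      (fun _ => isDensity_pushDensity isDensity_unif _) fun _ => isDensity_unif).trans ?_
    rw [Finset.sum_const, Finset.card_univ, Fintype.card_fin, nsmul_eq_mul]
    refine le_of_eq ?_
    congr 1
    refine Finset.sum_congr rfl fun y _ => ?_
    simp only [one_mul, Ex_sub, Ex_const (isDensity_unif (X := Fin n → Bool))]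
    rfl
  rw [← Ex_const (p := unif (Fin n → V)) isDensity_unif (Ex (unif (Fin m → V)) Θ), ← Ex_sub]
  refine (abs_Ex_le_Ex_abs isDensity_unif _).trans ?_
  refine (Ex_mono isDensity_unif hC).trans ?_
  rw [Ex_const_mul, Ex_const_mul]
  gcongr
  exact Ex_sum_abs_subsetSum_le (fun _ => 1) (by simp)

end SubsetSum

/-! ### The truncated discrete Gaussian -/

lemma gaussWeight_nonneg {q : ℕ} (B : ℝ) (x : ZMod q) : 0 ≤ gaussWeight q B x := by
  unfold gaussWeight
  split <;> positivity

lemma gaussWeight_zero {q : ℕ} {B : ℝ} (hB : 0 ≤ B) : gaussWeight q B 0 = 1 := by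
  simp [gaussWeight, hB]

section Gauss

variable {q : ℕ} [NeZero q]

/-- Around the cycle ℤ_q the values descend from `g 0` to the antipode and climb back, so the total
variation is twice that drop. -/
lemma sum_abs_sub_shift_le (g : ℕ → ℝ) (hg : Antitone g) (h0 : ∀ t, 0 ≤ g t) :
    ∑ x : ZMod q, |g x.valMinAbs.natAbs - g (x - 1).valMinAbs.natAbs| ≤ 2 * g 0 := by
  have hq : 0 < q := Nat.pos_of_ne_zero (NeZero.ne q)
  let F : ℕ → ℝ := fun i => g (min i (q - i))
  have hF : ∀ i, i ≤ q → g ((i : ZMod q)).valMinAbs.natAbs = F i := by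
    intro i hi
    rcases hi.lt_or_eq with hi | rfl
    · rw [ZMod.valMinAbs_natAbs_eq_min, ZMod.val_natCast_of_lt hi]
    · simp [F]
  have h1 : ∑ x : ZMod q, |g x.valMinAbs.natAbs - g (x - 1).valMinAbs.natAbs| =
      ∑ i ∈ Finset.range q, |F (i + 1) - F i| := by
    rw [← Equiv.sum_comp (Equiv.addRight (1 : ZMod q))]
    simp only [Equiv.coe_addRight, add_sub_cancel_right]
    symm
    refine Finset.sum_bij (fun i _ => (i : ZMod q)) (by simp) ?_ ?_ ?_
    · intro i hi j hj h
      have := congrArg ZMod.val h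
      rwa [ZMod.val_natCast_of_lt (Finset.mem_range.1 hi),
        ZMod.val_natCast_of_lt (Finset.mem_range.1 hj)] at this
    · intro x _
      exact ⟨x.val, Finset.mem_range.2 (ZMod.val_lt x), by simp⟩
    · intro i hi
      have hi := Finset.mem_range.1 hi
      rw [← hF i hi.le, ← hF (i + 1) hi]
      push_cast
      rfl
  rw [h1, ← Finset.sum_range_add_sum_Ico _ (Nat.div_le_self q 2)]
  have h2 : ∑ i ∈ Finset.range (q / 2), |F (i + 1) - F i| = F 0 - F (q / 2) := by
    rw [← Finset.sum_range_sub']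
    refine Finset.sum_congr rfl fun i hi => ?_
    have hi := Finset.mem_range.1 hi
    rw [abs_sub_comm, abs_of_nonneg]
    exact sub_nonneg.2 (hg (by omega))
  have h3 : ∑ i ∈ Finset.Ico (q / 2) q, |F (i + 1) - F i| = F q - F (q / 2) := by
    rw [← Finset.sum_Ico_sub _ (Nat.div_le_self q 2)]
    refine Finset.sum_congr rfl fun i hi => ?_
    have hi := Finset.mem_Ico.1 hi
    rw [abs_of_nonneg]
    exact sub_nonneg.2 (hg (by omega))
  rw [h2, h3]
  have h4 : F 0 = g 0 := by simp [F]
  have h5 : F q = g 0 := by simp [F]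
  have := h0 (min (q / 2) (q - q / 2))
  simp only [F] at *
  linarith

lemma sum_gaussWeight_pos {B : ℝ} (hB : 0 ≤ B) : 0 < ∑ y : ZMod q, gaussWeight q B y :=
  Finset.sum_pos' (fun x _ => gaussWeight_nonneg B x)
    ⟨0, Finset.mem_univ _, by rw [gaussWeight_zero hB]; exact one_pos⟩

lemma isDensity_gauss {B : ℝ} (hB : 0 ≤ B) : IsDensity (gauss q B) := by
  refine ⟨fun x => div_nonneg (gaussWeight_nonneg B x) (sum_gaussWeight_pos hB).le, ?_⟩
  unfold gauss
  rw [← Finset.sum_div, div_self (sum_gaussWeight_pos hB).ne']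

lemma abs_valMinAbs_le_of_gauss_ne_zero {B : ℝ} {x : ZMod q} (h : gauss q B x ≠ 0) :
    |(x.valMinAbs : ℝ)| ≤ B := by
  by_contra hx
  simp [gauss, gaussWeight, hx] at h

lemma sum_abs_gauss_shift_one_le {B : ℝ} (hB : 0 < B) :
    ∑ x : ZMod q, |gauss q B x - gauss q B (x - 1)| ≤ 2 * gauss q B 0 := by
  set S := ∑ y : ZMod q, gaussWeight q B y with hS
  have hSpos : 0 < S := sum_gaussWeight_pos hB.le
  let g : ℕ → ℝ := fun t =>
    (if (t : ℝ) ≤ B then Real.exp (-Real.pi * (t : ℝ) ^ 2 / B ^ 2) else 0) / S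
  have hg : ∀ x : ZMod q, gauss q B x = g x.valMinAbs.natAbs := by
    intro x
    have : ((x.valMinAbs.natAbs : ℕ) : ℝ) = |(x.valMinAbs : ℝ)| := by
      rw [Nat.cast_natAbs, Int.cast_abs]
    simp only [g, gauss, gaussWeight, this, sq_abs]
    rfl
  have hnonneg : ∀ t, 0 ≤ g t := fun t =>
    div_nonneg (by split <;> positivity) hSpos.le
  have hanti : Antitone g := by
    intro s t hst
    have hst' : (s : ℝ) ≤ t := by exact_mod_cast hst
    refine div_le_div_of_nonneg_right ?_ hSpos.le
    by_cases ht : (t : ℝ) ≤ B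
    · rw [if_pos ht, if_pos (hst'.trans ht)]
      refine Real.exp_le_exp.2 (div_le_div_of_nonneg_right ?_ (by positivity))
      have : (s : ℝ) ^ 2 ≤ (t : ℝ) ^ 2 := by gcongr
      nlinarith [Real.pi_pos]
    · rw [if_neg ht]
      split <;> positivity
  have := sum_abs_sub_shift_le (q := q) g hanti hnonneg
  simp only [hg]
  simpa using this

lemma sum_abs_shift_nat_le (f : ZMod q → ℝ) (t : ℕ) :
    ∑ x, |f (x - t) - f x| ≤ t * ∑ x, |f x - f (x - 1)| := by
  induction t with
  | zero => simp
  | succ t ih =>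
    have h : ∑ x, |f (x - (t + 1 : ℕ)) - f (x - t)| = ∑ x, |f x - f (x - 1)| := by
      rw [← Equiv.sum_comp (Equiv.subRight (t : ZMod q)) fun x => |f x - f (x - 1)|]
      refine Finset.sum_congr rfl fun x _ => ?_
      rw [abs_sub_comm, Equiv.subRight_apply, sub_sub, Nat.cast_succ]
    calc _ ≤ ∑ x, (|f (x - (t + 1 : ℕ)) - f (x - t)| + |f (x - t) - f x|) :=
          Finset.sum_le_sum fun x _ => abs_sub_le _ _ _
      _ ≤ _ := by
          rw [Finset.sum_add_distrib, h]
          push_cast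
          linarith

lemma sum_abs_shift_int_le (f : ZMod q → ℝ) (z : ℤ) :
    ∑ x, |f (x - z) - f x| ≤ |(z : ℝ)| * ∑ x, |f x - f (x - 1)| := by
  rcases Int.eq_nat_or_neg z with ⟨t, rfl | rfl⟩
  · simpa using sum_abs_shift_nat_le f t
  · have := sum_abs_shift_nat_le f t
    rw [← Equiv.sum_comp (Equiv.addRight (t : ZMod q))] at this
    simpa [abs_sub_comm] using this

lemma sum_abs_gauss_shift_le {B : ℝ} (hB : 0 < B) (z : ℤ) :
    ∑ x : ZMod q, |gauss q B (x - z) - gauss q B x| ≤ |(z : ℝ)| * (2 * gauss q B 0) :=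
  (sum_abs_shift_int_le _ z).trans
    (mul_le_mul_of_nonneg_left (sum_abs_gauss_shift_one_le hB) (abs_nonneg _))

/-- The points 0, …, ⌊B⌋ have weight at least exp(-π) each, so the normalising sum is at least
exp(-π)·B. The bound B ≤ q/2 keeps them distinct and equal to their centred representatives. -/
lemma gauss_zero_le {B : ℝ} (hB : 0 < B) (hq : B ≤ q / 2) :
    gauss q B 0 ≤ Real.exp Real.pi / B := by
  have key : Real.exp (-Real.pi) * B ≤ ∑ y : ZMod q, gaussWeight q B y := by
    have hfl : ⌊B⌋₊ ≤ q / 2 := by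
      rw [Nat.le_div_iff_mul_le two_pos]
      have : (⌊B⌋₊ : ℝ) ≤ B := Nat.floor_le hB.le
      have : ((⌊B⌋₊ * 2 : ℕ) : ℝ) ≤ q := by push_cast; linarith
      exact_mod_cast this
    have hqpos : 0 < q := Nat.pos_of_ne_zero (NeZero.ne q)
    have hlt : ⌊B⌋₊ < q := lt_of_le_of_lt hfl (Nat.div_lt_self hqpos one_lt_two)
    have hinj : Set.InjOn (fun i : ℕ => (i : ZMod q)) (Finset.range (⌊B⌋₊ + 1)) := by
      intro i hi j hj h
      have hi : i < ⌊B⌋₊ + 1 := by simpa using hi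
      have hj : j < ⌊B⌋₊ + 1 := by simpa using hj
      have := congrArg ZMod.val h
      simpa only [ZMod.val_natCast_of_lt (show i < q by omega),
        ZMod.val_natCast_of_lt (show j < q by omega)] using this
    calc Real.exp (-Real.pi) * B ≤ Real.exp (-Real.pi) * (⌊B⌋₊ + 1 : ℕ) := by
          have := (Nat.lt_floor_add_one B).le
          push_cast
          gcongr
      _ = ∑ i ∈ Finset.range (⌊B⌋₊ + 1), Real.exp (-Real.pi) := by simp [mul_comm]
      _ ≤ ∑ i ∈ Finset.range (⌊B⌋₊ + 1), gaussWeight q B (i : ZMod q) := by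
          refine Finset.sum_le_sum fun i hi => ?_
          have hi : i ≤ ⌊B⌋₊ := by simpa [Nat.lt_succ_iff] using hi
          have hiB : (i : ℝ) ≤ B := (Nat.cast_le.2 hi).trans (Nat.floor_le hB.le)
          have hv : (i : ZMod q).valMinAbs = i := ZMod.valMinAbs_natCast_of_le_half (hi.trans hfl)
          rw [gaussWeight, hv, Int.cast_natCast, if_pos (by rwa [abs_of_nonneg (by positivity)])]
          refine Real.exp_le_exp.2 ?_
          rw [le_div_iff₀ (by positivity)]
          have : (i : ℝ) ^ 2 ≤ B ^ 2 := by gcongr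
          nlinarith [Real.pi_pos]
      _ = ∑ y ∈ (Finset.range (⌊B⌋₊ + 1)).image (fun i : ℕ => (i : ZMod q)),
            gaussWeight q B y := (Finset.sum_image hinj).symm
      _ ≤ _ := Finset.sum_le_sum_of_subset_of_nonneg (Finset.subset_univ _)
          fun x _ _ => gaussWeight_nonneg B x
  rw [gauss, gaussWeight_zero hB.le, div_le_div_iff₀ (sum_gaussWeight_pos hB.le) hB, one_mul]
  calc B = Real.exp Real.pi * (Real.exp (-Real.pi) * B) := by
        rw [← mul_assoc, ← Real.exp_add, add_neg_cancel, Real.exp_zero, one_mul]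
    _ ≤ _ := mul_le_mul_of_nonneg_left key (Real.exp_pos _).le

end Gauss

/-! ### Affine functions over `ℤ_q` -/

/-- `F` is an affine function of the vector `v`. -/
def IsAff {q : ℕ} {I : Type} [Fintype I] (F : (I → ZMod q) → ZMod q) : Prop :=
  ∃ (a : I → ZMod q) (c : ZMod q), ∀ v, F v = c + ∑ i, a i * v i

section IsAff

variable {q : ℕ} {I : Type} [Fintype I] {F G : (I → ZMod q) → ZMod q}

lemma isAff_const (c : ZMod q) : IsAff fun _ : I → ZMod q => c :=
  ⟨0, c, by simp⟩

lemma isAff_apply (i : I) : IsAff fun v : I → ZMod q => v i := by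
  classical
  exact ⟨fun j => if j = i then 1 else 0, 0, by simp⟩

lemma IsAff.add (hF : IsAff F) (hG : IsAff G) : IsAff fun v => F v + G v := by
  obtain ⟨a, c, h⟩ := hF
  obtain ⟨a', c', h'⟩ := hG
  exact ⟨fun i => a i + a' i, c + c', fun v => by
    simp only [h, h']; simp only [add_mul, Finset.sum_add_distrib]; ring⟩

lemma IsAff.mul_const (hF : IsAff F) (b : ZMod q) : IsAff fun v => F v * b := by
  obtain ⟨a, c, h⟩ := hF
  exact ⟨fun i => a i * b, c * b, fun v => by
    simp only [h, add_mul, Finset.sum_mul]; congr 1; exact Finset.sum_congr rfl fun i _ => by ring⟩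

lemma IsAff.sum {T : Type} (s : Finset T) {F : T → (I → ZMod q) → ZMod q}
    (hF : ∀ t, IsAff (F t)) : IsAff fun v => ∑ t ∈ s, F t v := by
  classical
  induction s using Finset.induction_on with
  | empty => simpa using isAff_const 0
  | insert t s ht ih => simpa only [Finset.sum_insert ht] using (hF t).add ih

lemma IsAff.ite (p : Prop) [Decidable p] (hF : IsAff F) (hG : IsAff G) :
    IsAff fun v => if p then F v else G v := by
  by_cases h : p <;> simpa [h]

end IsAff

/-- A matrix together with a vector, as one vector. -/
def keyVec {q m n : ℕ} (A : Fin m → Fin n → ZMod q) (u : Fin m → ZMod q) :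
    (Fin m × Fin n) ⊕ Fin m → ZMod q :=
  Sum.elim (fun ij => A ij.1 ij.2) u

/-! ### Amplification of the number of samples -/

lemma subsetSum_apply {q k : ℕ} {J : Type} (B : Fin k → J → ZMod q) (r : Fin k → Bool) (j : J) :
    subsetSum B r j = ∑ a, if r a then B a j else 0 := by
  unfold subsetSum
  rw [Finset.sum_apply]
  exact Finset.sum_congr rfl fun a _ => by split <;> rfl

lemma subsetSum_add {k : ℕ} {V : Type} [AddCommGroup V] (v w : Fin k → V) (r : Fin k → Bool) :
    subsetSum (v + w) r = subsetSum v r + subsetSum w r := by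
  unfold subsetSum
  rw [← Finset.sum_add_distrib]
  exact Finset.sum_congr rfl fun a _ => by split <;> simp

lemma Ex_unif_add_right {X : Type} [Fintype X] [AddGroup X] (g : X) (f : X → ℝ) :
    Ex (unif X) (fun x => f (x + g)) = Ex (unif X) f :=
  (Ex_unif_equiv (Equiv.addRight g) f).symm

lemma subsetSum_mulVec {q k ℓ : ℕ} (B : Fin k → Fin ℓ → ZMod q) (c : Fin ℓ → ZMod q) (r : Fin k → Bool) :
    subsetSum (Matrix.mulVec B c) r = ∑ j, subsetSum B r j * c j := by
  simp only [subsetSum_apply, Finset.sum_mul]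
  rw [Finset.sum_comm]
  unfold subsetSum
  refine Finset.sum_congr rfl fun a _ => ?_
  cases r a <;> simp [Matrix.mulVec, dotProduct]

section Amplify

variable {q ℓ m n k : ℕ} [NeZero q]

/-- The test `ψ` distinguishes LWE samples with error density `χ` from uniform ones with advantage
at most `μ`. -/
def LWEBound (χ : ZMod q → ℝ) (ψ : (Fin k → Fin ℓ → ZMod q) → (Fin k → ZMod q) → ℝ) (μ : ℝ) :
    Prop :=
  |Ex (unif (Fin k → Fin ℓ → ZMod q)) (fun B => Ex (unif (Fin ℓ → ZMod q)) fun s =>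
      Ex (iidDensity k χ) fun e => ψ B (Matrix.mulVec B s + e)) -
    Ex (unif (Fin k → Fin ℓ → ZMod q)) (fun B => Ex (unif (Fin k → ZMod q)) fun u => ψ B u)| ≤ μ

/-- Internal randomness of a reduction: the signed advantage of a mixture is the mixture of the
signed advantages. -/
lemma LWEBound.average {χ : ZMod q → ℝ} {Z : Type} [Fintype Z] {r : Z → ℝ} (hr : IsDensity r)
    {ψ : Z → (Fin k → Fin ℓ → ZMod q) → (Fin k → ZMod q) → ℝ} {μ : ℝ}
    (h : ∀ z, LWEBound χ (ψ z) μ) :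
    LWEBound χ (fun B v => Ex r fun z => ψ z B v) μ := by
  unfold LWEBound
  have h1 : ∀ B : Fin k → Fin ℓ → ZMod q, (Ex (unif (Fin ℓ → ZMod q)) fun s =>
      Ex (iidDensity k χ) fun e => Ex r fun z => ψ z B (Matrix.mulVec B s + e)) =
      Ex r fun z => Ex (unif (Fin ℓ → ZMod q)) fun s =>
        Ex (iidDensity k χ) fun e => ψ z B (Matrix.mulVec B s + e) := by
    intro B
    exact (Ex_congr fun s => Ex_comm _ _ _).trans (Ex_comm _ _ _)
  simp only [h1]
  rw [Ex_comm]
  simp only [fun B : Fin k → Fin ℓ → ZMod q => Ex_comm (unif (Fin k → ZMod q)) r fun u z => ψ z B u]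
  rw [Ex_comm (unif (Fin k → Fin ℓ → ZMod q)) r fun B z =>
    Ex (unif (Fin k → ZMod q)) fun u => ψ z B u]
  exact abs_Ex_sub_le hr h

/-- From `k` samples with error density `χ` one obtains `m` samples with a wider error density
`χ'`, by taking random subset sums and adding fresh errors. -/
theorem LWEBound.amplify {χ χ' : ZMod q → ℝ} (hχ : IsDensity χ) (hχ' : IsDensity χ')
    (ψ : (Fin m → Fin ℓ → ZMod q) → (Fin m → ZMod q) → ℝ) (hψ : ∀ B v, |ψ B v| ≤ 1) {μ σ : ℝ}
    (hμ : ∀ (R : Fin m → Fin k → Bool) (g : Fin m → ZMod q),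
      LWEBound χ (fun (B : Fin k → Fin ℓ → ZMod q) v =>
        ψ (fun i => subsetSum B (R i)) ((fun i => subsetSum v (R i)) + g)) μ)
    (hσ : ∀ e : Fin k → ZMod q, iidDensity k χ e ≠ 0 → ∀ r : Fin k → Bool,
      ∑ x, |χ' (x - subsetSum e r) - χ' x| ≤ σ) :
    LWEBound χ' ψ (μ + m * σ + 2 * (m * Real.sqrt ((q : ℝ) ^ (ℓ + 1) / 2 ^ k))) := by
  have hq1 : (1 : ℝ) ≤ q := by exact_mod_cast Nat.pos_of_ne_zero (NeZero.ne q)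
  -- Chain of games: `X1` has LWE samples with error `χ'`; `X2` replaces the matrix by RB; `X3`
  -- replaces the error by Re + g; `X4` makes the `k` given samples uniform; `X5` is uniform. The
  -- links are leftover hashing, flooding, LWE, and leftover hashing again.
  let X1 := Ex (unif (Fin m → Fin ℓ → ZMod q)) fun B => Ex (unif (Fin ℓ → ZMod q)) fun c =>
    Ex (iidDensity m χ') fun g => ψ B (Matrix.mulVec B c + g)
  let X2 := Ex (unif (Fin k → Fin ℓ → ZMod q)) fun B => Ex (unif (Fin m → Fin k → Bool)) fun R =>
    Ex (unif (Fin ℓ → ZMod q)) fun c => Ex (iidDensity m χ') fun g =>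
      ψ (fun i => subsetSum B (R i)) (Matrix.mulVec (fun i => subsetSum B (R i)) c + g)
  let X3 := Ex (unif (Fin k → Fin ℓ → ZMod q)) fun B => Ex (unif (Fin m → Fin k → Bool)) fun R =>
    Ex (unif (Fin ℓ → ZMod q)) fun c => Ex (iidDensity k χ) fun e => Ex (iidDensity m χ') fun g =>
      ψ (fun i => subsetSum B (R i)) ((fun i => subsetSum (Matrix.mulVec B c + e) (R i)) + g)
  let X4 := Ex (unif (Fin m → Fin k → Bool)) fun R => Ex (iidDensity m χ') fun g =>
    Ex (unif (Fin k → Fin ℓ → ZMod q)) fun B => Ex (unif (Fin k → ZMod q)) fun v =>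
      ψ (fun i => subsetSum B (R i)) ((fun i => subsetSum v (R i)) + g)
  let X5 := Ex (unif (Fin m → Fin ℓ → ZMod q)) fun B => Ex (unif (Fin m → ZMod q)) fun v => ψ B v
  have hiid := isDensity_iid m hχ'
  have h12 : |X2 - X1| ≤ m * Real.sqrt ((q : ℝ) ^ (ℓ + 1) / 2 ^ k) := by
    have := abs_Ex_subsetSum_sub_le (n := k) (fun B : Fin m → Fin ℓ → ZMod q =>
      Ex (unif (Fin ℓ → ZMod q)) fun c => Ex (iidDensity m χ') fun g =>
        ψ B (Matrix.mulVec B c + g)) zero_le_one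
      fun B => abs_Ex_le isDensity_unif fun c => abs_Ex_le hiid fun g => hψ _ _
    refine this.trans ?_
    rw [one_mul]
    have hc : ((Fintype.card (Fin ℓ → ZMod q) : ℕ) : ℝ) = (q : ℝ) ^ ℓ := by
      simp [ZMod.card]
    rw [hc]
    gcongr
    exact Nat.le_succ ℓ
  have h23 : |X3 - X2| ≤ m * σ := by
    refine abs_Ex_sub_le isDensity_unif fun B => abs_Ex_sub_le isDensity_unif fun R =>
      abs_Ex_sub_le isDensity_unif fun c => ?_
    rw [← Ex_const (isDensity_iid k hχ) (Ex (iidDensity m χ') fun g =>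
      ψ (fun i => subsetSum B (R i)) (Matrix.mulVec (fun i => subsetSum B (R i)) c + g)), ← Ex_sub]
    -- The truncation of the Gaussian enters here: flooding is required only for errors in the
    -- support.
    refine abs_Ex_le_of_support (isDensity_iid k hχ) fun e he => ?_
    have := abs_Ex_iid_add_sub_le hχ' (fun i => subsetSum e (R i)) (fun g =>
      ψ (fun i => subsetSum B (R i)) (Matrix.mulVec (fun i => subsetSum B (R i)) c + g))
      zero_le_one fun g => hψ _ _
    rw [one_mul] at this
    have heq : ∀ g : Fin m → ZMod q, (fun i => subsetSum (Matrix.mulVec B c + e) (R i)) + g =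
        Matrix.mulVec (fun i => subsetSum B (R i)) c + (g + fun i => subsetSum e (R i)) := by
      intro g
      funext i
      simp only [Pi.add_apply, subsetSum_add, subsetSum_mulVec, Matrix.mulVec, dotProduct]
      ring
    simp only [heq]
    refine this.trans ?_
    calc _ ≤ ∑ _i : Fin m, σ := Finset.sum_le_sum fun i _ => hσ e he _
      _ = m * σ := by simp
  have h34 : |X3 - X4| ≤ μ := by
    have h3 : X3 = Ex (unif (Fin m → Fin k → Bool)) fun R => Ex (iidDensity m χ') fun g =>
        Ex (unif (Fin k → Fin ℓ → ZMod q)) fun B => Ex (unif (Fin ℓ → ZMod q)) fun c =>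
        Ex (iidDensity k χ) fun e =>
          ψ (fun i => subsetSum B (R i))
            ((fun i => subsetSum (Matrix.mulVec B c + e) (R i)) + g) := by
      simp only [X3]
      exact (Ex_comm _ _ _).trans (Ex_congr fun R => (Ex_congr fun B =>
        (Ex_congr fun c => Ex_comm _ _ _).trans (Ex_comm _ _ _)).trans (Ex_comm _ _ _))
    rw [h3]
    exact abs_Ex_sub_le isDensity_unif fun R => abs_Ex_sub_le hiid fun g => hμ R g
  have h45 : |X4 - X5| ≤ m * Real.sqrt ((q : ℝ) ^ (ℓ + 1) / 2 ^ k) := by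
    -- The matrix rows are hashed jointly with the entries of `v`, in a group of order q^(ℓ+1).
    have := abs_Ex_subsetSum_sub_le (n := k) (fun Y : Fin m → (Fin ℓ → ZMod q) × ZMod q =>
      Ex (iidDensity m χ') fun g => ψ (fun i => (Y i).1) ((fun i => (Y i).2) + g)) zero_le_one
      fun Y => abs_Ex_le hiid fun g => hψ _ _
    have hc : ((Fintype.card ((Fin ℓ → ZMod q) × ZMod q) : ℕ) : ℝ) = (q : ℝ) ^ (ℓ + 1) := by
      simp [ZMod.card, pow_succ]
    rw [hc, one_mul, Ex_unif_equiv (Equiv.arrowProdEquivProdArrow (Fin k) _ _).symm,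
      Ex_unif_equiv (Equiv.arrowProdEquivProdArrow (Fin m) _ _).symm, Ex_unif_prod,
      Ex_unif_prod] at this
    have h4 : X4 = Ex (unif (Fin k → Fin ℓ → ZMod q)) fun B => Ex (unif (Fin k → ZMod q)) fun v =>
        Ex (unif (Fin m → Fin k → Bool)) fun R => Ex (iidDensity m χ') fun g =>
          ψ (fun i => subsetSum B (R i)) ((fun i => subsetSum v (R i)) + g) := by
      simp only [X4]
      exact (Ex_congr fun R => (Ex_comm _ _ _).trans (Ex_congr fun B => Ex_comm _ _ _)).trans
        ((Ex_comm _ _ _).trans (Ex_congr fun B => Ex_comm _ _ _))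
    have h5 : X5 = Ex (unif (Fin m → Fin ℓ → ZMod q)) fun B => Ex (unif (Fin m → ZMod q)) fun v =>
        Ex (iidDensity m χ') fun g => ψ B (v + g) := by
      simp only [X5]
      refine Ex_congr fun B => ?_
      rw [Ex_comm]
      simp only [Ex_unif_add_right, Ex_const hiid]
    rw [h4, h5]
    have hfst : ∀ (B : Fin k → Fin ℓ → ZMod q) (v : Fin k → ZMod q) (r : Fin k → Bool),
        subsetSum ((Equiv.arrowProdEquivProdArrow (Fin k) (fun _ => Fin ℓ → ZMod q)
          fun _ => ZMod q).symm (B, v)) r = (subsetSum B r, subsetSum v r) := by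
      intro B v r
      unfold subsetSum
      ext1 <;> simp [Prod.fst_sum, Prod.snd_sum, apply_ite Prod.fst, apply_ite Prod.snd]
    simp only [hfst] at this
    exact this
  have : |X1 - X5| ≤ _ := (abs_sub_le X1 X2 X5).trans (add_le_add (abs_sub_comm X1 X2 ▸ h12)
    ((abs_sub_le X2 X3 X5).trans (add_le_add (abs_sub_comm X2 X3 ▸ h23)
      ((abs_sub_le X3 X4 X5).trans (add_le_add h34 h45)))))
  unfold LWEBound
  refine this.trans (le_of_eq ?_)
  ring

end Amplify

/-! ### The lossy mode -/

section Hybrid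

variable {q ℓ m n k : ℕ}

/-- The matrix whose first `t` columns are LWE samples `B c + f` and whose other columns are given
by `U`. -/
def colMat (B : Fin m → Fin ℓ → ZMod q) (C : Fin n → Fin ℓ → ZMod q)
    (F U : Fin n → Fin m → ZMod q) (t : ℕ) : Matrix (Fin m) (Fin n) (ZMod q) :=
  fun i j => if (j : ℕ) < t then Matrix.mulVec B (C j) i + F j i else U j i

/-- The matrix with columns `U`, with column `t` replaced by `v`, and with the columns before it
replaced by LWE samples. -/
def pivotMat (C : Fin n → Fin ℓ → ZMod q) (F U : Fin n → Fin m → ZMod q) (t : ℕ)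
    (B : Fin m → Fin ℓ → ZMod q) (v : Fin m → ZMod q) : Matrix (Fin m) (Fin n) (ZMod q) :=
  fun i j => if (j : ℕ) < t then Matrix.mulVec B (C j) i + F j i
    else if (j : ℕ) = t then v i else U j i

/-- Isolates column `t`: `c` and `f` drop out, and the column is the uniform `u`. One stage later it
is an LWE sample for the same `B` that serves the earlier columns. -/
lemma colMat_update (B : Fin m → Fin ℓ → ZMod q) (C : Fin n → Fin ℓ → ZMod q)
    (F U : Fin n → Fin m → ZMod q) (t : Fin n) (c : Fin ℓ → ZMod q) (f u : Fin m → ZMod q) :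
    colMat B (Function.update C t c) (Function.update F t f) (Function.update U t u) t =
      pivotMat C F U t B u := by
  funext i j
  unfold colMat pivotMat
  rcases lt_trichotomy j t with h | rfl | h
  · simp [h, h.ne]
  · simp
  · have h' : ¬ ((j : ℕ) < t) := not_lt.2 (Fin.lt_def.1 h).le
    have h'' : (j : ℕ) ≠ t := (Fin.lt_def.1 h).ne'
    simp [h', h'', h.ne']

lemma colMat_succ_update (B : Fin m → Fin ℓ → ZMod q) (C : Fin n → Fin ℓ → ZMod q)
    (F U : Fin n → Fin m → ZMod q) (t : Fin n) (c : Fin ℓ → ZMod q) (f u : Fin m → ZMod q) :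
    colMat B (Function.update C t c) (Function.update F t f) (Function.update U t u) (t + 1) =
      pivotMat C F U t B (Matrix.mulVec B c + f) := by
  funext i j
  unfold colMat pivotMat
  rcases lt_trichotomy j t with h | rfl | h
  · have : (j : ℕ) < t + 1 := (Fin.lt_def.1 h).trans (Nat.lt_succ_self _)
    simp [h, h.ne, this]
  · simp
  · have h' : ¬ ((j : ℕ) < t) := not_lt.2 (Fin.lt_def.1 h).le
    have h'' : (j : ℕ) ≠ t := (Fin.lt_def.1 h).ne'
    have h3 : ¬ ((j : ℕ) < t + 1) := by omega
    simp [h', h'', h3, h.ne']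

lemma colMat_zero (B : Fin m → Fin ℓ → ZMod q) (C : Fin n → Fin ℓ → ZMod q)
    (F U : Fin n → Fin m → ZMod q) : colMat B C F U 0 = fun i j => U j i := by
  funext i j
  simp [colMat]

lemma isAff_key {I : Type} [Fintype I] (M : (I → ZMod q) → Matrix (Fin m) (Fin n) (ZMod q))
    (hM : ∀ i j, IsAff fun w => M w i j) (s : Fin n → ZMod q) (e : Fin m → ZMod q)
    (o : (Fin m × Fin n) ⊕ Fin m) :
    IsAff fun w => keyVec (M w) ((M w).mulVec s + e) o := by
  rcases o with ⟨i, j⟩ | i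
  · exact hM i j
  · simp only [keyVec, Sum.elim_inr, Pi.add_apply, Matrix.mulVec, dotProduct]
    exact (IsAff.sum _ fun j => (hM i j).mul_const _).add (isAff_const _)

lemma isAff_subsetSum {I : Type} [Fintype I] (v : (I → ZMod q) → Fin k → ZMod q)
    (hv : ∀ a, IsAff fun w => v w a) (r : Fin k → Bool) :
    IsAff fun w => subsetSum (v w) r :=
  IsAff.sum _ fun a => IsAff.ite _ (hv a) (isAff_const 0)

/-- The reduction chooses `C` and `F` itself, so the earlier columns are affine in the challenge
matrix. -/
lemma isAff_pivotMat {I : Type} [Fintype I] (C : Fin n → Fin ℓ → ZMod q)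
    (F U : Fin n → Fin m → ZMod q) (t : ℕ) (B : (I → ZMod q) → Fin m → Fin ℓ → ZMod q)
    (v : (I → ZMod q) → Fin m → ZMod q) (hB : ∀ i j, IsAff fun w => B w i j)
    (hv : ∀ i, IsAff fun w => v w i) (i : Fin m) (j : Fin n) :
    IsAff fun w => pivotMat C F U t (B w) (v w) i j := by
  unfold pivotMat
  refine IsAff.ite _ ?_ (IsAff.ite _ (hv i) (isAff_const _))
  simp only [Matrix.mulVec, dotProduct]
  exact (IsAff.sum _ fun a => (hB i a).mul_const _).add (isAff_const _)

/-- Makes the data of column `t` the innermost average, so that all other columns can be fixed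
before LWE is applied. -/
lemma Ex_resample_three {X Y Z : Type} [Fintype X] [Fintype Y] [Fintype Z] [Nonempty X]
    [Nonempty Z] {χ : Y → ℝ} (hχ : IsDensity χ) (t : Fin n)
    (g : (Fin n → X) → (Fin n → Y) → (Fin n → Z) → ℝ) :
    (Ex (unif (Fin n → X)) fun C => Ex (iidDensity n χ) fun F => Ex (unif (Fin n → Z)) fun U =>
      g C F U) =
    Ex (unif (Fin n → X)) fun C => Ex (iidDensity n χ) fun F => Ex (unif (Fin n → Z)) fun U =>
      Ex (unif X) fun c => Ex χ fun f => Ex (unif Z) fun u =>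
        g (Function.update C t c) (Function.update F t f) (Function.update U t u) := by
  have hA : ∀ (C : Fin n → X), (Ex (iidDensity n χ) fun F => Ex (unif (Fin n → Z)) fun U =>
      g C F U) = Ex (iidDensity n χ) fun F => Ex (unif (Fin n → Z)) fun U => Ex χ fun f =>
        Ex (unif Z) fun u => g C (Function.update F t f) (Function.update U t u) := by
    intro C
    rw [Ex_iid_resample hχ t]
    refine Ex_congr fun F => ?_
    rw [Ex_comm (unif (Fin n → Z)) χ fun U f => Ex (unif Z) fun u =>
      g C (Function.update F t f) (Function.update U t u)]
    exact Ex_congr fun f => Ex_unif_resample t fun U => g C (Function.update F t f) U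
  simp only [hA]
  rw [Ex_unif_resample t]
  refine Ex_congr fun C => (Ex_comm (unif X) (iidDensity n χ) _).trans (Ex_congr fun F => ?_)
  exact Ex_comm (unif X) (unif (Fin n → Z)) _

lemma mulVec_bitsToZMod (A : Matrix (Fin m) (Fin n) (ZMod q)) (s : Fin n → Bool) :
    A.mulVec (bitsToZMod q s) = subsetSum (fun j i => A i j) s := by
  funext i
  simp [subsetSum_apply, Matrix.mulVec, dotProduct, bitsToZMod]

lemma colMat_mulVec_bits (B : Fin m → Fin ℓ → ZMod q) (C : Fin n → Fin ℓ → ZMod q)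
    (F U : Fin n → Fin m → ZMod q) (s : Fin n → Bool) :
    (colMat B C F U n).mulVec (bitsToZMod q s) =
      Matrix.mulVec B (subsetSum C s) + subsetSum F s := by
  have hc : (fun (j : Fin n) (i : Fin m) => colMat B C F U n i j) =
      (fun j => Matrix.mulVec B (C j)) + F := by
    funext j i
    simp [colMat]
  rw [mulVec_bitsToZMod, hc, subsetSum_add]
  congr 1
  unfold subsetSum
  rw [show Matrix.mulVec B = (Matrix.mulVecLin B : (Fin ℓ → ZMod q) → Fin m → ZMod q) from rfl,
    map_sum]
  exact Finset.sum_congr rfl fun j _ => by split <;> simp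

variable [NeZero q]

/-- The average over the column data of the correlation of `h` with `χ`, when the first `t` columns
are lossy. -/
def hybridEx (χs : (Fin n → Bool) → ℝ) (χF χe : ZMod q → ℝ)
    (h : Matrix (Fin m) (Fin n) (ZMod q) → (Fin m → ZMod q) → ℝ) (ℓ t : ℕ) : ℝ :=
  Ex (unif (Fin n → Bool)) fun s => χs s *
    Ex (unif (Fin n → Fin ℓ → ZMod q)) fun C => Ex (iidDensity n (iidDensity m χF)) fun F =>
    Ex (unif (Fin n → Fin m → ZMod q)) fun U => Ex (unif (Fin m → Fin ℓ → ZMod q)) fun B =>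
    Ex (iidDensity m χe) fun e =>
      h (colMat B C F U t) ((colMat B C F U t).mulVec (bitsToZMod q s) + e)

/-- With `s` and the other columns' data fixed, the two stages differ in one column, uniform against
Bc + f. Completing it to a key is affine in the `k` samples behind the amplified challenge. -/
lemma abs_hybridEx_sub_succ_le {χs : (Fin n → Bool) → ℝ} (hχs : ∀ s, |χs s| ≤ 1)
    {χ χF χe : ZMod q → ℝ} (hχ : IsDensity χ) (hχF : IsDensity χF) (hχe : IsDensity χe)
    (h : Matrix (Fin m) (Fin n) (ZMod q) → (Fin m → ZMod q) → ℝ) (hh : ∀ A u, |h A u| ≤ 1)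
    {μ σ : ℝ}
    (hμ : ∀ G : ((Fin k × Fin ℓ) ⊕ Fin k → ZMod q) → (Fin m × Fin n) ⊕ Fin m → ZMod q,
      (∀ o, IsAff fun w => G w o) → LWEBound χ (fun B v =>
        h (fun i j => G (keyVec B v) (Sum.inl (i, j))) fun i => G (keyVec B v) (Sum.inr i)) μ)
    (hσ : ∀ e : Fin k → ZMod q, iidDensity k χ e ≠ 0 → ∀ r : Fin k → Bool,
      ∑ x, |χF (x - subsetSum e r) - χF x| ≤ σ) (t : Fin n) :
    |hybridEx χs χF χe h ℓ t - hybridEx χs χF χe h ℓ (t + 1)| ≤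
      μ + m * σ + 2 * (m * Real.sqrt ((q : ℝ) ^ (ℓ + 1) / 2 ^ k)) := by
  have hF := isDensity_iid m hχF
  unfold hybridEx
  refine abs_Ex_sub_le isDensity_unif fun s => ?_
  rw [← mul_sub, abs_mul]
  refine (mul_le_of_le_one_left (abs_nonneg _) (hχs s)).trans ?_
  refine le_of_eq_of_le (congrArg abs (congrArg₂ (· - ·) (Ex_resample_three hF t _)
    (Ex_resample_three hF t _))) ?_
  refine abs_Ex_sub_le isDensity_unif fun C => abs_Ex_sub_le (isDensity_iid n hF) fun F =>
    abs_Ex_sub_le isDensity_unif fun U => ?_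
  simp only [colMat_update, colMat_succ_update]
  have hamp := LWEBound.amplify hχ hχF (fun B v => Ex (iidDensity m χe) fun e =>
      h (pivotMat C F U t B v) ((pivotMat C F U t B v).mulVec (bitsToZMod q s) + e))
    (fun B v => abs_Ex_le (isDensity_iid m hχe) fun e => hh _ _)
    (fun R g => LWEBound.average (isDensity_iid m hχe) fun e =>
      hμ (fun w => keyVec
        (pivotMat C F U t (fun i => subsetSum (fun a b => w (Sum.inl (a, b))) (R i))
          ((fun i => subsetSum (fun a => w (Sum.inr a)) (R i)) + g))
        ((pivotMat C F U t (fun i => subsetSum (fun a b => w (Sum.inl (a, b))) (R i))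
          ((fun i => subsetSum (fun a => w (Sum.inr a)) (R i)) + g)).mulVec (bitsToZMod q s) + e))
        (isAff_key _ (isAff_pivotMat C F U t _ _
          (fun i j => by
            simp only [subsetSum_apply]
            exact IsAff.sum _ fun a => IsAff.ite _ (isAff_apply _) (isAff_const 0))
          fun i => (isAff_subsetSum _ (fun a => isAff_apply _) _).add (isAff_const _)) _ _))
    hσ
  rw [abs_sub_comm]
  refine le_trans (le_of_eq ?_) hamp
  congr 2
  · refine Eq.trans ?_ (Ex_comm _ _ _)
    refine Ex_congr fun c => Eq.trans ?_ (Ex_comm _ _ _)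
    exact Ex_congr fun f => Ex_const isDensity_unif _
  · refine (Ex_const isDensity_unif _).trans ((Ex_const hF _).trans ?_)
    exact Ex_comm _ _ _

/-- A balanced character of a random bit string is hidden by a random subset sum. -/
lemma abs_Ex_mul_subsetSum_le {V : Type} [AddCommGroup V] [Fintype V] [DecidableEq V]
    {χs : (Fin n → Bool) → ℝ} (hχs : ∀ s, |χs s| ≤ 1) (h0 : Ex (unif (Fin n → Bool)) χs = 0)
    (f : (Fin n → V) → V → ℝ) (hf : ∀ C y, |f C y| ≤ 1) :
    |Ex (unif (Fin n → V)) fun C => Ex (unif (Fin n → Bool)) fun s =>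
      χs s * f C (subsetSum C s)| ≤ Real.sqrt (Fintype.card V / 2 ^ n) := by
  refine ((abs_Ex_le_Ex_abs isDensity_unif _).trans (Ex_mono isDensity_unif fun C => ?_)).trans
    (Ex_sum_abs_subsetSum_le χs hχs)
  have h1 : (Ex (unif (Fin n → Bool)) fun s => χs s * f C (subsetSum C s)) =
      ∑ y, f C y * Ex (unif (Fin n → Bool)) fun s =>
        χs s * ((if subsetSum C s = y then 1 else 0) - 1 / (Fintype.card V : ℝ)) := by
    -- As `χs` has mean zero, subtracting the uniform baseline costs nothing.
    simp only [mul_sub, Ex_sub, Ex_mul_const, h0, zero_mul, sub_zero]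
    simp only [Ex, Finset.mul_sum]
    rw [Finset.sum_comm]
    refine Finset.sum_congr rfl fun s _ => ?_
    rw [Finset.sum_eq_single (subsetSum C s)]
    · simp only [if_true]
      ring
    · intro y _ hy
      simp [hy.symm]
    · simp
  rw [h1]
  refine (Finset.abs_sum_le_sum_abs _ _).trans (Finset.sum_le_sum fun y _ => ?_)
  rw [abs_mul]
  exact mul_le_of_le_one_left (abs_nonneg _) (hf C y)

/-- With every column lossy, the key vector is B(Cs) + Fs + e. Once `e` has absorbed Fs, the secret
occurs only through Cs, which hides the balanced character. -/
lemma abs_hybridEx_last_le {χs : (Fin n → Bool) → ℝ} (hχs : ∀ s, |χs s| ≤ 1)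
    (h0 : Ex (unif (Fin n → Bool)) χs = 0)
    {χF χe : ZMod q → ℝ} (hχF : IsDensity χF) (hχe : IsDensity χe)
    (h : Matrix (Fin m) (Fin n) (ZMod q) → (Fin m → ZMod q) → ℝ) (hh : ∀ A u, |h A u| ≤ 1)
    {τ : ℝ} (hτ : ∀ f : Fin n → ZMod q, iidDensity n χF f ≠ 0 → ∀ s : Fin n → Bool,
      ∑ x, |χe (x - subsetSum f s) - χe x| ≤ τ) :
    |hybridEx χs χF χe h ℓ n| ≤ m * τ + Real.sqrt ((q : ℝ) ^ ℓ / 2 ^ n) := by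
  have hF := isDensity_iid m hχF
  let f : (Fin n → Fin ℓ → ZMod q) → (Fin ℓ → ZMod q) → ℝ := fun C y =>
    Ex (iidDensity n (iidDensity m χF)) fun F =>
    Ex (unif (Fin n → Fin m → ZMod q)) fun U => Ex (unif (Fin m → Fin ℓ → ZMod q)) fun B =>
    Ex (iidDensity m χe) fun e => h (colMat B C F U n) (Matrix.mulVec B y + e)
  have h1 : |hybridEx χs χF χe h ℓ n - Ex (unif (Fin n → Bool)) fun s => χs s *
      Ex (unif (Fin n → Fin ℓ → ZMod q)) fun C => f C (subsetSum C s)| ≤ m * τ := by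
    unfold hybridEx
    refine abs_Ex_sub_le isDensity_unif fun s => ?_
    rw [← mul_sub, abs_mul]
    refine (mul_le_of_le_one_left (abs_nonneg _) (hχs s)).trans ?_
    refine abs_Ex_sub_le isDensity_unif fun C => ?_
    rw [← Ex_sub]
    refine abs_Ex_le_of_support (isDensity_iid n hF) fun F hFne => ?_
    refine abs_Ex_sub_le isDensity_unif fun U => abs_Ex_sub_le isDensity_unif fun B => ?_
    have := abs_Ex_iid_add_sub_le hχe (subsetSum F s)
      (fun e => h (colMat B C F U n) (Matrix.mulVec B (subsetSum C s) + e)) zero_le_one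
      fun e => hh _ _
    rw [one_mul] at this
    simp only [colMat_mulVec_bits]
    have heq : ∀ e : Fin m → ZMod q, Matrix.mulVec B (subsetSum C s) + subsetSum F s + e =
        Matrix.mulVec B (subsetSum C s) + (e + subsetSum F s) := fun e => by
      rw [add_assoc, add_comm (subsetSum F s)]
    simp only [heq]
    refine this.trans ?_
    calc _ ≤ ∑ _i : Fin m, τ := by
          refine Finset.sum_le_sum fun i _ => ?_
          have hi : iidDensity n χF (fun j => F j i) ≠ 0 := by
            unfold iidDensity at hFne ⊢
            rw [Finset.prod_ne_zero_iff] at hFne ⊢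
            exact fun j hj => (Finset.prod_ne_zero_iff.1 (hFne j hj)) i (Finset.mem_univ i)
          have := hτ _ hi s
          rwa [subsetSum_apply]
      _ = m * τ := by simp
  have h2 := abs_Ex_mul_subsetSum_le hχs h0 f fun C y => abs_Ex_le (isDensity_iid n hF) fun F =>
    abs_Ex_le isDensity_unif fun U => abs_Ex_le isDensity_unif fun B =>
      abs_Ex_le (isDensity_iid m hχe) fun e => hh _ _
  rw [Ex_comm] at h2
  simp only [Ex_const_mul] at h2
  have hc : ((Fintype.card (Fin ℓ → ZMod q) : ℕ) : ℝ) = (q : ℝ) ^ ℓ := by simp [ZMod.card]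
  rw [hc] at h2
  have := abs_sub_abs_le_abs_sub (hybridEx χs χF χe h ℓ n) (Ex (unif (Fin n → Bool)) fun s =>
    χs s * Ex (unif (Fin n → Fin ℓ → ZMod q)) fun C => f C (subsetSum C s))
  linarith

/-- The correlation of any key test with a balanced character of the secret is small, if all affine
reductions to it satisfy the LWE bound. -/
theorem abs_correlation_le {χs : (Fin n → Bool) → ℝ} (hχs : ∀ s, |χs s| ≤ 1)
    (h0 : Ex (unif (Fin n → Bool)) χs = 0)
    {χ χF χe : ZMod q → ℝ} (hχ : IsDensity χ) (hχF : IsDensity χF) (hχe : IsDensity χe)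
    (h : Matrix (Fin m) (Fin n) (ZMod q) → (Fin m → ZMod q) → ℝ) (hh : ∀ A u, |h A u| ≤ 1)
    {μ σ τ : ℝ}
    (hμ : ∀ G : ((Fin k × Fin ℓ) ⊕ Fin k → ZMod q) → (Fin m × Fin n) ⊕ Fin m → ZMod q,
      (∀ o, IsAff fun w => G w o) → LWEBound χ (fun B v =>
        h (fun i j => G (keyVec B v) (Sum.inl (i, j))) fun i => G (keyVec B v) (Sum.inr i)) μ)
    (hσ : ∀ e : Fin k → ZMod q, iidDensity k χ e ≠ 0 → ∀ r : Fin k → Bool,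
      ∑ x, |χF (x - subsetSum e r) - χF x| ≤ σ)
    (hτ : ∀ f : Fin n → ZMod q, iidDensity n χF f ≠ 0 → ∀ s : Fin n → Bool,
      ∑ x, |χe (x - subsetSum f s) - χe x| ≤ τ) :
    |Ex (unif (Matrix (Fin m) (Fin n) (ZMod q))) fun A => Ex (unif (Fin n → Bool)) fun s =>
      Ex (iidDensity m χe) fun e => χs s * h A (A.mulVec (bitsToZMod q s) + e)| ≤
      n * (μ + m * σ + 2 * (m * Real.sqrt ((q : ℝ) ^ (ℓ + 1) / 2 ^ k))) +
        (m * τ + Real.sqrt ((q : ℝ) ^ ℓ / 2 ^ n)) := by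
  set ε := μ + m * σ + 2 * (m * Real.sqrt ((q : ℝ) ^ (ℓ + 1) / 2 ^ k)) with hε
  -- At stage 0 the columns are the uniform `U`, and `C`, `F`, `B` average out.
  have hfirst : (Ex (unif (Matrix (Fin m) (Fin n) (ZMod q))) fun A =>
      Ex (unif (Fin n → Bool)) fun s => Ex (iidDensity m χe) fun e =>
        χs s * h A (A.mulVec (bitsToZMod q s) + e)) = hybridEx χs χF χe h ℓ 0 := by
    rw [Ex_comm]
    refine Ex_congr fun s => ?_
    simp only [Ex_const_mul, colMat_zero]
    congr 1
    rw [Ex_const isDensity_unif, Ex_const (isDensity_iid n (isDensity_iid m hχF))]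
    refine (Ex_unif_equiv ((Equiv.piComm fun (_ : Fin n) (_ : Fin m) => ZMod q).trans
      Matrix.of) _).trans ?_
    exact Ex_congr fun U => (Ex_const isDensity_unif _).symm
  have hsteps : ∀ t : ℕ, t ≤ n →
      |hybridEx χs χF χe h ℓ 0 - hybridEx χs χF χe h ℓ t| ≤ t * ε := by
    intro t
    induction t with
    | zero => simp
    | succ t ih =>
      intro ht
      have h1 := ih (by omega)
      have h2 := abs_hybridEx_sub_succ_le hχs hχ hχF hχe h hh hμ hσ ⟨t, ht⟩
      have h3 := abs_sub_le (hybridEx χs χF χe h ℓ 0) (hybridEx χs χF χe h ℓ t)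
        (hybridEx χs χF χe h ℓ (t + 1))
      push_cast
      simp only at h2
      linarith
  rw [hfirst]
  have h1 := hsteps n le_rfl
  have h2 := abs_hybridEx_last_le (ℓ := ℓ) hχs h0 hχF hχe h hh hτ
  have h3 := abs_sub_abs_le_abs_sub (hybridEx χs χF χe h ℓ 0) (hybridEx χs χF χe h ℓ n)
  linarith

end Hybrid

/-! ### The hardcore bit -/

/-- Makes the hardcore set nonempty: 1 - s_i is 0 or 1. -/
lemma noWrap_one {q n : ℕ} (hq : 1 < q) (s : Fin n → Bool) :
    NoWrap false s (fun _ => (1 : ZMod q)) := by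
  have : Fact (1 < q) := ⟨hq⟩
  intro i
  cases h : s i <;> simp [shift, bitsToZMod, h, ZMod.val_one]

/-- The representatives differ by ±s_i as integers, so their parities differ exactly when s_i = 1.
-/
lemma testBit_zero_xor_of_noWrap {q n : ℕ} {b : Bool} {s : Fin n → Bool} {x : Fin n → ZMod q}
    (h : NoWrap b s x) (i : Fin n) :
    xor ((x i).val.testBit 0) ((shift b s x i).val.testBit 0) = s i := by
  have hi := h i
  rw [Nat.testBit_zero, Nat.testBit_zero]
  cases b <;> cases hs : s i <;> simp only [hs, Bool.toNat_false, Bool.toNat_true, pow_zero,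
    pow_one, Nat.cast_zero, Nat.cast_one] at hi
  · have : (shift false s x i).val = (x i).val := by omega
    simp [this]
  · rcases Nat.mod_two_eq_zero_or_one (x i).val with h0 | h0
    · have : (shift false s x i).val % 2 = 1 := by omega
      simp [h0, this]
    · have : (shift false s x i).val % 2 = 0 := by omega
      simp [h0, this]
  · have : (shift true s x i).val = (x i).val := by omega
    simp [this]
  · rcases Nat.mod_two_eq_zero_or_one (x i).val with h0 | h0
    · have : (shift true s x i).val % 2 = 1 := by omega
      simp [h0, this]
    · have : (shift true s x i).val % 2 = 0 := by omega
      simp [h0, this]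

/-- As `d` has entries 0 and 1, its binary form lives on least significant bits, so only those bits
of `z` count. -/
lemma dotBit_J {q n : ℕ} (hq : 1 < q) (d : Fin n → Bool)
    (z : Fin n × Fin (Nat.clog 2 q) → Bool) (s : Fin n → Bool)
    (hz : ∀ i (k : Fin (Nat.clog 2 q)), (k : ℕ) = 0 → z (i, k) = s i) :
    dotBit (J (bitsToZMod q d)) z = dotBit d s := by
  have : Fact (1 < q) := ⟨hq⟩
  have hL : 0 < Nat.clog 2 q := Nat.clog_pos one_lt_two hq
  have hJ : ∀ i k, J (bitsToZMod q d) (i, k) = (d i && decide ((k : ℕ) = 0)) := by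
    intro i k
    cases h : d i
    · simp [J, bitsToZMod, h]
    · rw [J, bitsToZMod, if_pos h, ZMod.val_one, Bool.true_and, Bool.eq_iff_iff,
        Nat.testBit_one_eq_true_iff_self_eq_zero, decide_eq_true_iff]
  unfold dotBit
  rw [Fintype.sum_prod_type]
  have : ∀ i, ∑ k, (J (bitsToZMod q d) (i, k) && z (i, k)).toNat = (d i && s i).toNat := by
    intro i
    rw [Finset.sum_eq_single ⟨0, hL⟩]
    · rw [hJ, hz _ _ rfl]
      simp
    · intro k _ hk
      have : (k : ℕ) ≠ 0 := fun h => hk (Fin.ext h)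
      simp [hJ, this]
    · simp
  simp only [this]

/-- For `d̂ ∈ {0,1}^n`, the set `H'_{s,J(d̂)}` consists of the single bit `d̂ · s`. -/
lemma hardcoreSet_J {q n : ℕ} (hq : 1 < q) (s d : Fin n → Bool) :
    hardcoreSet q s (J (bitsToZMod q d)) = {dotBit d s} := by
  have key : ∀ (b : Bool) (x : Fin n → ZMod q), NoWrap b s x →
      dotBit (J (bitsToZMod q d)) (xorStr (J x) (J (shift b s x))) = dotBit d s := by
    intro b x h
    refine dotBit_J hq d _ s fun i k hk => ?_
    simp only [xorStr, J, hk]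
    exact testBit_zero_xor_of_noWrap h i
  ext c
  constructor
  · rintro ⟨b, x, h, rfl⟩
    exact key b x h
  · rintro rfl
    exact ⟨false, _, noWrap_one hq s, (key _ _ (noWrap_one hq s)).symm⟩

/-- The sign `(-1)^{d · s}`. -/
def signBit {n : ℕ} (d s : Fin n → Bool) : ℝ := if dotBit d s then -1 else 1

lemma abs_signBit_le {n : ℕ} (d s : Fin n → Bool) : |signBit d s| ≤ 1 := by
  unfold signBit
  split <;> simp

lemma signBit_eq_prod {n : ℕ} (d s : Fin n → Bool) :
    signBit d s = ∏ i, (-1 : ℝ) ^ (d i && s i).toNat := by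
  rw [Finset.prod_pow_eq_pow_sum, neg_one_pow_eq_ite, signBit, dotBit]
  rcases Nat.mod_two_eq_zero_or_one (∑ i, (d i && s i).toNat) with h | h <;>
    simp [Nat.even_iff, h]

/-- Redrawing a bit s_j with d_j = 1 balances the sign; this is where d ≠ 0 is needed. -/
lemma Ex_signBit {n : ℕ} (d : Fin n → Bool) (hd : ∃ i, d i = true) :
    Ex (unif (Fin n → Bool)) (signBit d) = 0 := by
  obtain ⟨j, hj⟩ := hd
  rw [Ex_unif_resample j]
  have : ∀ s : Fin n → Bool, (Ex (unif Bool) fun x => signBit d (Function.update s j x)) = 0 := by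
    intro s
    simp only [signBit_eq_prod, ← Finset.mul_prod_erase Finset.univ _ (Finset.mem_univ j),
      Function.update_self, hj, Bool.true_and]
    have h : ∀ x : Bool, ∏ i ∈ Finset.univ.erase j,
        (-1 : ℝ) ^ (d i && Function.update s j x i).toNat =
        ∏ i ∈ Finset.univ.erase j, (-1 : ℝ) ^ (d i && s i).toNat := fun x =>
      Finset.prod_congr rfl fun i hi => by
        rw [Function.update_of_ne (Finset.ne_of_mem_erase hi)]
    simp only [h, Ex, unif, Fintype.sum_bool]
    simp
  simp only [this]
  exact Ex_const isDensity_unif 0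

lemma QCircuit.probMem_dotBit {ι : Type} [Fintype ι] [DecidableEq ι] (C : QCircuit ι)
    (x : ι → Bool) {n : ℕ} (d s : Fin n → Bool) :
    C.probMem x {dotBit d s} = 1 / 2 + signBit d s * (1 / 2 - C.probMem x {true}) := by
  have := C.probMem_false_add_true x
  unfold signBit
  cases dotBit d s
  · simp only [Bool.false_eq_true, if_false]
    linarith
  · simp only [if_true]
    linarith

/-- The bias of a circuit: one half minus the probability of the output `1`. -/
def keyBias {q m n : ℕ} (C : QCircuit (KeyWires q m n)) (A : Matrix (Fin m) (Fin n) (ZMod q))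
    (u : Fin m → ZMod q) : ℝ :=
  1 / 2 - C.probMem (encodeKey A u) {true}

lemma abs_keyBias_le {q m n : ℕ} (C : QCircuit (KeyWires q m n))
    (A : Matrix (Fin m) (Fin n) (ZMod q)) (u : Fin m → ZMod q) : |keyBias C A u| ≤ 1 := by
  have h1 := C.probMem_false_add_true (encodeKey A u)
  have h2 := C.probMem_nonneg (encodeKey A u) {true}
  have h3 := C.probMem_nonneg (encodeKey A u) {false}
  unfold keyBias
  rw [abs_le]
  constructor <;> linarith

lemma probHardcore_sub_half {q m n : ℕ} [NeZero q] (hq : 1 < q)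
    {P : Matrix (Fin m) (Fin n) (ZMod q) → ℝ} (hP : IsDensity P) {B : ℝ} (hB : 0 ≤ B)
    (d : Fin n → Bool) (C : QCircuit (KeyWires q m n)) :
    probHardcore P B (J (bitsToZMod q d)) C - 1 / 2 =
      Ex P fun A => Ex (unif (Fin n → Bool)) fun s => Ex (iidDensity m (gauss q B)) fun e =>
        signBit d s * keyBias C A (A.mulVec (bitsToZMod q s) + e) := by
  have h1 : probHardcore P B (J (bitsToZMod q d)) C =
      Ex P fun A => Ex (unif (Fin n → Bool)) fun s => Ex (iidDensity m (gauss q B)) fun e =>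
        C.probMem (encodeKey A (A.mulVec (bitsToZMod q s) + e)) {dotBit d s} := by
    unfold probHardcore Ex
    simp only [hardcoreSet_J hq, Finset.mul_sum]
    exact Finset.sum_congr rfl fun A _ => Finset.sum_congr rfl fun s _ =>
      Finset.sum_congr rfl fun e _ => by ring
  have h2 : (1 / 2 : ℝ) = Ex P fun _ => Ex (unif (Fin n → Bool)) fun _ =>
      Ex (iidDensity m (gauss q B)) fun _ => 1 / 2 := by
    rw [Ex_const (isDensity_iid m (isDensity_gauss hB)), Ex_const isDensity_unif, Ex_const hP]
  rw [h1, h2]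
  simp only [← Ex_sub]
  refine Ex_congr fun A => Ex_congr fun s => Ex_congr fun e => ?_
  rw [C.probMem_dotBit, keyBias]
  ring

lemma abs_Ex_sub_Ex_unif_le {X : Type} [Fintype X] (P f : X → ℝ) (hf : ∀ x, |f x| ≤ 1) :
    |Ex P f| ≤ |Ex (unif X) f| + 2 * tvDist P (unif X) := by
  have h1 := abs_Ex_sub_Ex_le P (unif X) f hf
  have h2 := abs_sub_abs_le_abs_sub (Ex P f) (Ex (unif X) f)
  unfold tvDist
  linarith

/-! ### Growth of functions of the security parameter -/

lemma PolyBounded.mono {f g : ℕ → ℕ} (hg : PolyBounded g) (h : ∀ k, f k ≤ g k) :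
    PolyBounded f := by
  obtain ⟨p, hp⟩ := hg
  exact ⟨p, fun k => (h k).trans (hp k)⟩

lemma PolyBounded.add {f g : ℕ → ℕ} (hf : PolyBounded f) (hg : PolyBounded g) :
    PolyBounded fun k => f k + g k := by
  obtain ⟨p, hp⟩ := hf
  obtain ⟨r, hr⟩ := hg
  exact ⟨p + r, fun k => by simpa using add_le_add (hp k) (hr k)⟩

lemma PolyBounded.mul {f g : ℕ → ℕ} (hf : PolyBounded f) (hg : PolyBounded g) :
    PolyBounded fun k => f k * g k := by
  obtain ⟨p, hp⟩ := hf
  obtain ⟨r, hr⟩ := hg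
  exact ⟨p * r, fun k => by simpa using Nat.mul_le_mul (hp k) (hr k)⟩

lemma polyBounded_const (a : ℕ) : PolyBounded fun _ => a :=
  ⟨Polynomial.C a, fun k => by simp⟩

lemma Negligible.of_eventually_le {f g : ℕ → ℝ} (hg : Negligible g)
    (h : ∀ᶠ k in atTop, |f k| ≤ g k) : Negligible f :=
  SuperpolynomialDecay.trans_eventually_abs_le hg
    (h.mono fun _ hk => hk.trans (le_abs_self _))

lemma Negligible.add {f g : ℕ → ℝ} (hf : Negligible f) (hg : Negligible g) :
    Negligible fun k => f k + g k :=
  SuperpolynomialDecay.add hf hg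

lemma Negligible.const_mul {f : ℕ → ℝ} (hf : Negligible f) (c : ℝ) :
    Negligible fun k => c * f k :=
  SuperpolynomialDecay.const_mul hf c

lemma Negligible.polyBounded_mul {f : ℕ → ℕ} {ν : ℕ → ℝ} (hf : PolyBounded f)
    (hν : Negligible ν) : Negligible fun k => f k * ν k := by
  obtain ⟨p, hp⟩ := hf
  have h := SuperpolynomialDecay.polynomial_mul hν (p.map (Nat.castRingHom ℝ))
  refine SuperpolynomialDecay.trans_abs_le h fun k => ?_
  simp only [abs_mul]
  refine mul_le_mul_of_nonneg_right ?_ (abs_nonneg _)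
  rw [Polynomial.eval_natCast_map, abs_of_nonneg (by positivity)]
  refine le_trans ?_ (le_abs_self _)
  simpa using (Nat.cast_le (α := ℝ)).2 (hp k)

/-- For k ≥ 1 and M ≥ N/a, k^N ν^a ≤ (k^M ν)^a. -/
lemma Negligible.rpow {ν : ℕ → ℝ} (hν : Negligible ν) (h0 : ∀ k, 0 ≤ ν k) {a : ℝ} (ha : 0 < a) :
    Negligible fun k => ν k ^ a := by
  intro N
  obtain ⟨M, hM⟩ := exists_nat_ge (N / a)
  have hM' : (N : ℝ) ≤ M * a := by rwa [div_le_iff₀ ha] at hM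
  have h1 := (hν M).rpow_const (Or.inr ha.le : (0 : ℝ) ≠ 0 ∨ 0 ≤ a)
  rw [Real.zero_rpow ha.ne'] at h1
  refine tendsto_of_tendsto_of_tendsto_of_le_of_le' tendsto_const_nhds h1
    (Eventually.of_forall fun k => mul_nonneg (by positivity) (Real.rpow_nonneg (h0 k) a)) ?_
  filter_upwards [eventually_ge_atTop 1] with k hk
  have hk' : (1 : ℝ) ≤ k := by exact_mod_cast hk
  rw [Real.mul_rpow (by positivity) (h0 k)]
  refine mul_le_mul_of_nonneg_right ?_ (Real.rpow_nonneg (h0 k) a)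
  rw [← Real.rpow_natCast, ← Real.rpow_natCast, ← Real.rpow_mul (by positivity)]
  exact Real.rpow_le_rpow_of_exponent_le hk' hM'

lemma Negligible.sqrt {ν : ℕ → ℝ} (hν : Negligible ν) (h0 : ∀ k, 0 ≤ ν k) :
    Negligible fun k => Real.sqrt (ν k) := by
  simp only [Real.sqrt_eq_rpow]
  exact hν.rpow h0 (by norm_num)

lemma SuperPoly.negligible_inv {f : ℕ → ℝ} (hf : SuperPoly f) : Negligible fun k => (f k)⁻¹ := by
  intro c
  refine (hf c).inv_tendsto_atTop.congr fun k => ?_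
  simp [div_eq_mul_inv]

/-! ### The computational assumption for affine reductions -/

lemma probLWE_eq {q m ℓ : ℕ} [NeZero q] (χ : ZMod q → ℝ) (C : QCircuit (KeyWires q m ℓ)) :
    probLWE χ C = Ex (unif (Fin m → Fin ℓ → ZMod q)) fun B => Ex (unif (Fin ℓ → ZMod q)) fun s =>
      Ex (iidDensity m χ) fun e => C.probMem (encodeKey B (Matrix.mulVec B s + e)) {true} := by
  unfold probLWE Ex
  simp only [Finset.mul_sum]
  exact Finset.sum_congr rfl fun A _ => Finset.sum_congr rfl fun s _ =>
    Finset.sum_congr rfl fun e _ => by rw [mul_assoc, mul_assoc]; rfl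

lemma probUnif_eq {q m ℓ : ℕ} [NeZero q] (C : QCircuit (KeyWires q m ℓ)) :
    probUnif C = Ex (unif (Fin m → Fin ℓ → ZMod q)) fun B => Ex (unif (Fin m → ZMod q)) fun u =>
      C.probMem (encodeKey B u) {true} := by
  unfold probUnif Ex
  simp only [Finset.mul_sum]
  exact Finset.sum_congr rfl fun A _ => Finset.sum_congr rfl fun s _ => by rw [mul_assoc]; rfl

/-- The LWE assumption bounds the advantage of all affine reductions to a polynomial-size circuit
by a single negligible function. -/
theorem LWEHard.exists_negligible_affine {ℓ q n m k : ℕ → ℕ} [∀ t, NeZero (q t)]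
    {χ : ∀ t, ZMod (q t) → ℝ} (hχ : ∀ t, IsDensity (χ t)) (hLWE : LWEHard ℓ q χ)
    (hk : ∃ p : Polynomial ℝ, ∀ t, (k t : ℝ) ≤ p.eval ((ℓ t : ℝ) * Real.logb 2 (q t)))
    (hℓ : PolyBounded ℓ) (hn : PolyBounded n) (hm : PolyBounded m) (hkp : PolyBounded k)
    (hL : PolyBounded fun t => Nat.clog 2 (q t))
    (𝒜 : ∀ t, QCircuit (KeyWires (q t) (m t) (n t))) (h𝒜 : IsQPT 𝒜) :
    ∃ μ : ℕ → ℝ, Negligible μ ∧ ∀ t,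
      ∀ G : ((Fin (k t) × Fin (ℓ t)) ⊕ Fin (k t) → ZMod (q t)) →
        (Fin (m t) × Fin (n t)) ⊕ Fin (m t) → ZMod (q t),
      (∀ o, IsAff fun w => G w o) → LWEBound (χ t) (fun B v =>
        keyBias (𝒜 t) (fun i j => G (keyVec B v) (Sum.inl (i, j)))
          fun i => G (keyVec B v) (Sum.inr i)) (μ t) := by
  choose R hRsize hR using fun t (z : ((Fin (m t) × Fin (n t)) ⊕ Fin (m t) →
      (Fin (k t) × Fin (ℓ t)) ⊕ Fin (k t) → ZMod (q t)) ×
      ((Fin (m t) × Fin (n t)) ⊕ Fin (m t) → ZMod (q t))) =>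
    (𝒜 t).exists_precompose_affine z.1 z.2
  -- There are finitely many affine maps over `ZMod (q t)`, so each `t` has a worst one. The family
  -- of worst circuits is itself admissible, and its advantage dominates that of every affine
  -- reduction.
  have hmax := fun t => Finite.exists_max fun z =>
    |probLWE (m := k t) (ℓ := ℓ t) (χ t) (R t z) - probUnif (m := k t) (ℓ := ℓ t) (R t z)|
  choose z hz using hmax
  obtain ⟨μ, hμ, hle⟩ := hLWE k hk (fun t => R t (z t)) (by
    refine PolyBounded.mono ?_ fun t => hRsize t (z t)
    simp only [Fintype.card_sum, Fintype.card_prod, Fintype.card_fin]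
    have hO := (hm.mul hn).add hm
    have hI := (hkp.mul hℓ).add hkp
    have h15 := ((polyBounded_const 15).mul hL).add (polyBounded_const 24)
    exact h𝒜.add ((polyBounded_const 3).mul (((polyBounded_const 2).add
      (hO.mul ((hI.mul hL).mul h15))).add (hO.mul hL))))
  refine ⟨μ, hμ, fun t G hG => ?_⟩
  choose M c hMc using hG
  have hGeq : ∀ w, G w = affineFun M c w := fun w => funext fun o => hMc o w
  have hb := (hz t (M, c)).trans (hle t)
  rw [probLWE_eq, probUnif_eq] at hb
  have hval : ∀ (B : Fin (k t) → Fin (ℓ t) → ZMod (q t)) v,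
      keyBias (𝒜 t) (fun i j => G (keyVec B v) (Sum.inl (i, j)))
        (fun i => G (keyVec B v) (Sum.inr i)) =
      1 / 2 - (R t (M, c)).probMem (encodeKey B v) {true} := by
    intro B v
    have h1 : (R t (M, c)).probMem (encodeKey B v) {true} =
        (𝒜 t).probMem (encodeVec (G (keyVec B v))) {true} := by
      rw [hGeq]
      exact hR t (M, c) (keyVec B v) {true}
    have h2 : encodeKey (fun i j => G (keyVec B v) (Sum.inl (i, j)))
        (fun i => G (keyVec B v) (Sum.inr i)) = encodeVec (G (keyVec B v)) := by
      funext w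
      rcases w with ⟨⟨i, j⟩ | i, a⟩ <;> rfl
    rw [h1, ← h2]
    rfl
  unfold LWEBound
  simp only [hval, Ex_sub, Ex_const (isDensity_iid (k t) (hχ t)),
    Ex_const (isDensity_unif (X := Fin (ℓ t) → ZMod (q t))),
    Ex_const (isDensity_unif (X := Fin (k t) → Fin (ℓ t) → ZMod (q t))),
    Ex_const (isDensity_unif (X := Fin (k t) → ZMod (q t)))]
  rw [sub_sub_sub_cancel_left, abs_sub_comm]
  exact hb

/-! ### Parameters -/

/-- A subset sum of truncated errors lifts to an integer of size at most kB, and a shift by z moves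
the wide Gaussian by at most |z| times twice its peak. -/
lemma sum_abs_gauss_shift_subsetSum_le {q k : ℕ} [NeZero q] {B B' : ℝ} (hB' : 0 < B')
    (hq : B' ≤ q / 2) (e : Fin k → ZMod q) (he : iidDensity k (gauss q B) e ≠ 0)
    (r : Fin k → Bool) :
    ∑ x, |gauss q B' (x - subsetSum e r) - gauss q B' x| ≤
      k * B * (2 * (Real.exp Real.pi / B')) := by
  let z : ℤ := ∑ a, if r a then (e a).valMinAbs else 0
  have hz : ((z : ℤ) : ZMod q) = subsetSum e r := by
    simp only [z, subsetSum, Int.cast_sum]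
    exact Finset.sum_congr rfl fun a _ => by split <;> simp
  have hzB : |(z : ℝ)| ≤ k * B := by
    simp only [z, Int.cast_sum]
    calc |∑ a, (((if r a then (e a).valMinAbs else 0 : ℤ)) : ℝ)|
        ≤ ∑ a, |(((if r a then (e a).valMinAbs else 0 : ℤ)) : ℝ)| :=
          Finset.abs_sum_le_sum_abs _ _
      _ ≤ ∑ _a : Fin k, B := by
          refine Finset.sum_le_sum fun a _ => ?_
          have ha := abs_valMinAbs_le_of_gauss_ne_zero
            (Finset.prod_ne_zero_iff.1 he a (Finset.mem_univ a))
          split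
          · exact ha
          · simpa using (abs_nonneg _).trans ha
      _ = k * B := by simp
  have hg := gauss_zero_le (q := q) hB' hq
  have hg0 : 0 ≤ gauss q B' 0 := (isDensity_gauss hB'.le).1 0
  rw [← hz]
  refine (sum_abs_gauss_shift_le hB' z).trans ?_
  exact mul_le_mul hzB (by linarith) (by linarith) ((abs_nonneg _).trans hzB)

lemma one_le_logb_two {q : ℕ} (hq : 2 ≤ q) : 1 ≤ Real.logb 2 q := by
  rw [Real.le_logb_iff_rpow_le one_lt_two (by positivity)]
  simpa using (Nat.cast_le (α := ℝ)).2 hq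

lemma clog_le_two_mul_logb {q : ℕ} (hq : 2 ≤ q) :
    (Nat.clog 2 q : ℝ) ≤ 2 * Real.logb 2 q := by
  have h1 := one_le_logb_two hq
  have h2 := Real.natCeil_logb_natCast 2 q
  have h3 := (Nat.ceil_lt_add_one (by linarith : 0 ≤ Real.logb 2 q)).le
  rw [Nat.cast_ofNat] at h2
  rw [← h2]
  linarith

/-- Uses ℓ + 2 ≤ 3ℓ: the factor 3 pays for the exponent ℓ + 1 and a spare factor q. -/
lemma pow_div_two_pow_clog_le {q ℓ : ℕ} (hq : 2 ≤ q) (hℓ : 1 ≤ ℓ) :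
    (q : ℝ) ^ (ℓ + 1) / 2 ^ (3 * (ℓ * Nat.clog 2 q)) ≤ 1 / q := by
  have hq0 : (0 : ℝ) < q := by positivity
  rw [div_le_div_iff₀ (by positivity) hq0, one_mul, ← pow_succ]
  have h : q ^ (ℓ + 1 + 1) ≤ 2 ^ (3 * (ℓ * Nat.clog 2 q)) := by
    calc q ^ (ℓ + 1 + 1) ≤ (2 ^ Nat.clog 2 q) ^ (ℓ + 1 + 1) :=
          Nat.pow_le_pow_left (Nat.le_pow_clog one_lt_two q) _
      _ = 2 ^ (Nat.clog 2 q * (ℓ + 1 + 1)) := (pow_mul _ _ _).symm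
      _ ≤ _ := by
          refine Nat.pow_le_pow_right two_pos ?_
          nlinarith [Nat.mul_le_mul_left (Nat.clog 2 q) hℓ]
  exact_mod_cast h

/-- The hypothesis on `n` gives 2^n ≥ q^(cℓ), which leaves q^((c-1)ℓ), at least q^(c-1). -/
lemma pow_div_two_pow_le {q ℓ n : ℕ} (hq : 2 ≤ q) (hℓ : 1 ≤ ℓ) {c : ℝ} (hc : 1 < c)
    (hn : c * (ℓ * Real.logb 2 q) ≤ n) :
    (q : ℝ) ^ ℓ / 2 ^ n ≤ (1 / q) ^ (c - 1) := by
  have hq1 : (1 : ℝ) ≤ q := by exact_mod_cast (by omega : 1 ≤ q)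
  have hq0 : (0 : ℝ) < q := by linarith
  have hℓ' : (1 : ℝ) ≤ ℓ := by exact_mod_cast hℓ
  have h2n : (q : ℝ) ^ (c * ℓ) ≤ 2 ^ n := by
    calc (q : ℝ) ^ (c * ℓ) = ((2 : ℝ) ^ Real.logb 2 q) ^ (c * ℓ) := by
          rw [Real.rpow_logb two_pos (by norm_num) hq0]
      _ = (2 : ℝ) ^ (c * (ℓ * Real.logb 2 q)) := by
          rw [← Real.rpow_mul two_pos.le]
          ring_nf
      _ ≤ (2 : ℝ) ^ (n : ℝ) := Real.rpow_le_rpow_of_exponent_le one_le_two hn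
      _ = 2 ^ n := Real.rpow_natCast _ _
  rw [one_div, Real.inv_rpow hq0.le, div_le_iff₀ (by positivity), ← Real.rpow_natCast]
  rw [← div_eq_inv_mul, le_div_iff₀ (by positivity), ← Real.rpow_add hq0]
  refine le_trans (Real.rpow_le_rpow_of_exponent_le hq1 ?_) h2n
  nlinarith

section Params

variable {C_T : ℝ} {q ℓ n m B_L B_V : ℕ → ℕ} {B_P : ℕ → ℝ}

lemma ParamConditions.two_mul_mul_le (hp : ParamConditions C_T q ℓ n m B_L B_V B_P)
    (hC : 0 < C_T) (k : ℕ) : 0 < B_P k ∧ 2 * C_T * B_P k ≤ q k := by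
  have hq := (hp.q_prime k).two_le
  have hq0 : (0 : ℝ) < q k := by positivity
  have hlog := one_le_logb_two hq
  have hS : 1 ≤ Real.sqrt (m k * n k * Real.logb 2 (q k)) := by
    rw [Real.one_le_sqrt]
    have hm : (1 : ℝ) ≤ m k := by exact_mod_cast hp.one_le_m k
    have hn : (1 : ℝ) ≤ n k := by exact_mod_cast hp.one_le_n k
    exact one_le_mul_of_one_le_of_one_le (one_le_mul_of_one_le_of_one_le hm hn) hlog
  rw [hp.B_P_eq]
  have hS0 : 0 < Real.sqrt (m k * n k * Real.logb 2 (q k)) := by linarith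
  refine ⟨by positivity, ?_⟩
  generalize Real.sqrt (m k * n k * Real.logb 2 (q k)) = S at hS hS0
  calc 2 * C_T * (q k / (2 * C_T * S)) = q k / S := by field_simp
    _ ≤ q k := div_le_self hq0.le hS

/-- From q ≥ 2 C_T B_P and B_V ≥ 1, q is at least a constant times the super-polynomial B_P / B_V.
-/
lemma ParamConditions.negligible_one_div_q (hp : ParamConditions C_T q ℓ n m B_L B_V B_P)
    (hC : 0 < C_T) : Negligible fun k => 1 / (q k : ℝ) := by
  refine (hp.ratio_PV.negligible_inv.const_mul (1 / (2 * C_T))).of_eventually_le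
    (Eventually.of_forall fun k => ?_)
  obtain ⟨h0, h1⟩ := hp.two_mul_mul_le hC k
  have hq0 : (0 : ℝ) < q k := by exact_mod_cast (hp.q_prime k).pos
  have hV : (1 : ℝ) ≤ B_V k := by
    exact_mod_cast (hp.one_le_B_L k).trans (hp.B_L_lt k).le
  rw [abs_of_nonneg (by positivity), inv_div, div_mul_div_comm, one_mul,
    div_le_div_iff₀ hq0 (by positivity), one_mul]
  nlinarith

lemma ParamConditions.eventually_le_half (hp : ParamConditions C_T q ℓ n m B_L B_V B_P)
    (hC : 0 < C_T) : ∀ᶠ k in atTop, (B_V k : ℝ) ≤ q k / 2 := by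
  -- Exponent 0 is plain divergence; the threshold 1 / C_T gives 2 B_V ≤ 2 C_T B_P ≤ q.
  have h := hp.ratio_PV 0
  filter_upwards [h.eventually_ge_atTop (1 / C_T)] with k hk
  obtain ⟨h0, h1⟩ := hp.two_mul_mul_le hC k
  have hV : (1 : ℝ) ≤ B_V k := by
    exact_mod_cast (hp.one_le_B_L k).trans (hp.B_L_lt k).le
  rw [pow_zero, div_one, div_le_div_iff₀ hC (by linarith)] at hk
  linarith

lemma ParamConditions.negligible_sqrt_ratio (hp : ParamConditions C_T q ℓ n m B_L B_V B_P) :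
    Negligible fun k => Real.sqrt ((B_L k : ℝ) / B_V k) := by
  have h := hp.ratio_VL.negligible_inv
  simp only [inv_div] at h
  exact h.sqrt fun k => by positivity

end Params

end LWE

end

/-! ### Choice of parameters and conclusion -/

theorem mainTheorem10
    (C_T : ℝ) (hC_T : 0 < C_T)
    (q ℓ n m B_L B_V : ℕ → ℕ) (B_P : ℕ → ℝ) [∀ k, NeZero (q k)]
    (hparams : LWE.ParamConditions C_T q ℓ n m B_L B_V B_P)
    (hLWE : LWE.LWEHard ℓ q (fun k => LWE.gauss (q k) (B_L k)))
    (P : ∀ k, Matrix (Fin (m k)) (Fin (n k)) (ZMod (q k)) → ℝ)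
    (hP : ∀ k, LWE.IsDensity (P k))
    (hP_unif : LWE.Negligible fun k => LWE.tvDist (P k) (LWE.unif _))
    (d : ∀ k, Fin (n k) → Bool) (hd : ∀ k, ∃ i, d k i = true)
    (𝒜 : ∀ k, LWE.QCircuit (LWE.KeyWires (q k) (m k) (n k))) (h𝒜 : LWE.IsQPT 𝒜) :
    ∃ μ : ℕ → ℝ, LWE.Negligible μ ∧ ∀ k,
      |LWE.probHardcore (P k) (B_V k) (LWE.J (LWE.bitsToZMod (q k) (d k))) (𝒜 k) - 1 / 2| ≤ μ k := by
  -- `μ` is the advantage itself, so estimates are needed only for large `k`, where the asymptotic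
  -- parameter conditions hold.
  refine ⟨_, ?_, fun k => le_rfl⟩
  have hq2 : ∀ k, 2 ≤ q k := fun k => (hparams.q_prime k).two_le
  -- Number of samples asked of LWE: at most 6ℓ log q, yet enough for leftover hashing in ℤ_q^(ℓ+1).
  let N : ℕ → ℕ := fun k => 3 * (ℓ k * Nat.clog 2 (q k))
  have hNpoly : ∃ p : Polynomial ℝ, ∀ k,
      (N k : ℝ) ≤ p.eval ((ℓ k : ℝ) * Real.logb 2 (q k)) := by
    refine ⟨Polynomial.C 6 * Polynomial.X, fun k => ?_⟩
    have := mul_le_mul_of_nonneg_left (LWE.clog_le_two_mul_logb (hq2 k)) (Nat.cast_nonneg (ℓ k))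
    simp only [N, Nat.cast_mul, Nat.cast_ofNat, Polynomial.eval_mul, Polynomial.eval_C,
      Polynomial.eval_X]
    linarith
  have hclog : LWE.PolyBounded fun k => Nat.clog 2 (q k) :=
    hparams.poly_w.mono fun k => Nat.le_mul_of_pos_left _ (hparams.one_le_n k)
  have hN : LWE.PolyBounded N :=
    (LWE.polyBounded_const 3).mul (hparams.poly_ℓ.mul hclog)
  have hL0 : ∀ k, (0 : ℝ) < B_L k := fun k => by exact_mod_cast hparams.one_le_B_L k
  have hV0 : ∀ k, (0 : ℝ) < B_V k := fun k => by
    exact_mod_cast (hparams.one_le_B_L k).trans (hparams.B_L_lt k).le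
  obtain ⟨μ, hμ, hbound⟩ := LWE.LWEHard.exists_negligible_affine
    (fun k => LWE.isDensity_gauss (hL0 k).le) hLWE hNpoly hparams.poly_ℓ hparams.poly_n
    hparams.poly_m hN hclog 𝒜 h𝒜
  obtain ⟨c, hc, hcn⟩ := hparams.n_large
  let ρ : ℕ → ℝ := fun k => Real.sqrt ((B_L k : ℝ) / B_V k)
  have hρ : LWE.Negligible ρ := hparams.negligible_sqrt_ratio
  have hqinv := hparams.negligible_one_div_q hC_T
  have hqinv0 : ∀ k, 0 ≤ 1 / (q k : ℝ) := fun k => by positivity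
  let E : ℝ := 2 * Real.exp Real.pi
  have hn := hparams.poly_n
  have hm := hparams.poly_m
  have hnegl : LWE.Negligible fun k =>
      ((n k : ℝ) * (μ k + (m k : ℝ) * ((N k : ℝ) * (E * ρ k)) +
        2 * ((m k : ℝ) * Real.sqrt (1 / (q k : ℝ)))) +
      ((m k : ℝ) * ((n k : ℝ) * (E * ρ k)) + Real.sqrt ((1 / (q k : ℝ)) ^ (c - 1)))) +
      2 * LWE.tvDist (P k) (LWE.unif _) :=
    ((((hμ.add (((hρ.const_mul E).polyBounded_mul hN).polyBounded_mul hm)).add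
      (((hqinv.sqrt hqinv0).polyBounded_mul hm).const_mul 2)).polyBounded_mul hn).add
      ((((hρ.const_mul E).polyBounded_mul hn).polyBounded_mul hm).add
      ((hqinv.rpow hqinv0 (by linarith : 0 < c - 1)).sqrt
        fun k => Real.rpow_nonneg (hqinv0 k) _))).add (hP_unif.const_mul 2)
  refine hnegl.of_eventually_le ?_
  filter_upwards [hcn, hparams.eventually_le_half hC_T] with k hck hVk
  rw [abs_abs, LWE.probHardcore_sub_half (hq2 k) (hP k) (hV0 k).le]
  refine (LWE.abs_Ex_sub_Ex_unif_le (P k) _ fun A => LWE.abs_Ex_le LWE.isDensity_unif fun s =>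
    LWE.abs_Ex_le (LWE.isDensity_iid _ (LWE.isDensity_gauss (hV0 k).le)) fun e => ?_).trans
    (add_le_add ?_ le_rfl)
  · rw [abs_mul]
    exact mul_le_one₀ (LWE.abs_signBit_le _ _) (abs_nonneg _) (LWE.abs_keyBias_le _ _ _)
  -- With the geometric mean as intermediate width, both floodings have the same ratio √(B_L / B_V).
  let B : ℝ := Real.sqrt ((B_L k : ℝ) * B_V k)
  have hB0 : 0 < B := Real.sqrt_pos.2 (mul_pos (hL0 k) (hV0 k))
  have hLV : (B_L k : ℝ) ≤ B_V k := by exact_mod_cast (hparams.B_L_lt k).le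
  have hBV : B ≤ B_V k := by
    refine Real.sqrt_le_iff.2 ⟨(hV0 k).le, ?_⟩
    nlinarith [hV0 k]
  have hρsqrt : ρ k = Real.sqrt (B_L k) / Real.sqrt (B_V k) := Real.sqrt_div (hL0 k).le _
  have hBsqrt : B = Real.sqrt (B_L k) * Real.sqrt (B_V k) := Real.sqrt_mul (hL0 k).le _
  have hsL := Real.sqrt_pos.2 (hL0 k)
  have hsV := Real.sqrt_pos.2 (hV0 k)
  have h1 : (B_L k : ℝ) * (2 * (Real.exp Real.pi / B)) = E * ρ k := by
    rw [hρsqrt, hBsqrt]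
    nth_rewrite 1 [← Real.mul_self_sqrt (hL0 k).le]
    simp only [E]
    field_simp
  have h2 : B * (2 * (Real.exp Real.pi / B_V k)) = E * ρ k := by
    rw [hρsqrt, hBsqrt]
    nth_rewrite 2 [← Real.mul_self_sqrt (hV0 k).le]
    simp only [E]
    field_simp
  refine (LWE.abs_correlation_le (μ := μ k) (σ := N k * (E * ρ k)) (τ := n k * (E * ρ k))
    (LWE.abs_signBit_le (d k)) (LWE.Ex_signBit (d k) (hd k))
    (LWE.isDensity_gauss (hL0 k).le) (LWE.isDensity_gauss hB0.le)
    (LWE.isDensity_gauss (hV0 k).le) (LWE.keyBias (𝒜 k)) (LWE.abs_keyBias_le (𝒜 k)) (hbound k)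
    (fun e he r => ?_) fun f hf s => ?_).trans ?_
  · refine (LWE.sum_abs_gauss_shift_subsetSum_le hB0 (hBV.trans hVk) e he r).trans (le_of_eq ?_)
    rw [mul_assoc, h1]
  · refine (LWE.sum_abs_gauss_shift_subsetSum_le (hV0 k) hVk f hf s).trans (le_of_eq ?_)
    rw [mul_assoc, h2]
  · have h3 := Real.sqrt_le_sqrt (LWE.pow_div_two_pow_clog_le (hq2 k) (hparams.one_le_ℓ k))
    have h4 := Real.sqrt_le_sqrt (LWE.pow_div_two_pow_le (hq2 k) (hparams.one_le_ℓ k) hc hck)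
    gcongr
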